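/- **Conventions.** Let $G$ be a locally compact second countable (Hausdorff) group with Haar measure $m$, and let $\mu$ be a Borel probability measure on $G$ that is *admissible and non-degenerate*: $\mu^{*k}\ll m$ for some $k\ge 1$, and the support of $\mu$ generates $G$ as a semigroup. All $G$-spaces are standard Borel with a measurable action of $G$, and carry probability measures that are quasi-invariant (their measure class is preserved by every $g\in G$). Spaces on which weak\* limits are taken are in compact models: they are compact metrizable and $G$ acts continuously. For such $X$, $\mathrm{Prob}(X)$ is the compact metrizable space of Borel probability measures with the weak\* topology and the push-forward action $gm(A)=m(g^{-1}A)$; on products $G$ acts diagonally. A *$G$-factor map* $\pi:(X,\nu)\to(Y,\eta)$ is a measurable map with $\pi_*\nu=\eta$ for which there are measurable conull sets $X_0\subseteq X$ ($G$-invariant) and $Y_0\subseteq Y$ such that $\pi(gx)=g\pi(x)$ for all $g\in G$, $x\in X_0$, and $\pi(X_0)=Y_0$. Let $\{\nu_y\}$ be the disintegration of $\nu$ along $\pi$: $y\mapsto\nu_y(A)$ is measurable for measurable $A$, $\nu_y(\pi^{-1}(y))=1$ for a.e. $y$, and $\nu=\int_Y\nu_y\,d\eta(y)$. For $\omega=(g_1,g_2,\dots)\in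 G^{\mathbb N}$ put $$\nu_{y,\omega}:=\lim_{n\to\infty} g_1\cdots g_n\,\nu_{g_n^{-1}\cdots g_1^{-1}y}$$ whenever this weak\* limit exists. The map $\pi$ is * *relatively measure-preserving* if $g\nu_{g^{-1}y}=\nu_y$ for all $g\in G$ and $\eta$-a.e. $y$, for a suitable version of the disintegration; * *relatively $\mu$-stationary* if $\nu_y=\int_G g\nu_{g^{-1}y}\,d\mu(g)$ for $\eta$-a.e. $y$; * *relatively proximal* if for $\eta$-a.e. $y$ and $\mu^{\mathbb N}$-a.e. $\omega$ the limit $\nu_{y,\omega}$ exists and is a point mass; * a *relative $\mu$-boundary* if it is relatively $\mu$-stationary and relatively proximal. Given relatively $\mu$-stationary $G$-factor maps $\pi_1:(X,\nu)\to(Y,\eta)$ and $\pi_2:(Z,\zeta)\to(Y,\eta)$, a *relative joining* is a probability measure $\iota$ on $X\times Z$ for which the projections $\mathrm{pr}_1:(X\times Z,\iota)\to(X,\nu)$ and $\mathrm{pr}_2:(X\times Z,\iota)\to(Z,\zeta)$ are $G$-factor maps, $\pi_1\circ\mathrm{pr}_1=\pi_2\circ\mathrm{pr}_2$ $\iota$-a.e.,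 and this common map to $(Y,\eta)$ is relatively $\mu$-stationary. Write $$\nu\vee\zeta:=\int_Y\int_{G^{\mathbb N}}\nu_{y,\omega}\otimes\zeta_{y,\omega}\,d\mu^{\mathbb N}(\omega)\,d\eta(y).$$ A $G$-factor map $f:(X,\nu)\to(Z,\zeta)$ with $\pi_2\circ f=\pi_1$ a.e. is *relatively 1-1 in the limit* if for $\eta$-a.e. $y$ and $\mu^{\mathbb N}$-a.e. $\omega$ the limits $\nu_{y,\omega}$ and $\zeta_{y,\omega}$ exist, $\zeta_{y,\omega}=f_*\nu_{y,\omega}$, and $f$ is injective on a measurable subset of $\pi_1^{-1}(y)$ of full $\nu_{y,\omega}$-measure. **Theorem (Relative Structure Theorem).** Let $X$ be a compact metrizable space on which $G$ acts continuously, with a Borel probability measure $\nu$; let $(Y,\eta)$ be a standard Borel probability $G$-space; and let $\pi:(X,\nu)\to(Y,\eta)$ be a relatively $\mu$-stationary $G$-factor map. Then there exist a Borel probability measure $\xi$ on $\mathrm{Prob}(X)$ and a relative $\mu$-boundary $\phi:(\mathrm{Prob}(X),\xi)\to(Y,\eta)$ such that $\nu\vee\xi$ is a relative joining of $\pi$ and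 $\phi$ on $X\times\mathrm{Prob}(X)$; in particular $\mathrm{pr}_1:(X\times\mathrm{Prob}(X),\nu\vee\xi)\to(X,\nu)$ and $\mathrm{pr}_2:(X\times\mathrm{Prob}(X),\nu\vee\xi)\to(\mathrm{Prob}(X),\xi)$ are $G$-factor maps and the square commutes: $\psi:=\pi\circ\mathrm{pr}_1=\phi\circ\mathrm{pr}_2$ almost everywhere. Moreover $\mathrm{pr}_1$ is relatively 1-1 in the limit over $(Y,\eta)$ (with respect to $\psi$ and $\pi$), and $\mathrm{pr}_2$ is relatively measure-preserving. -/

import Mathlib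

open MeasureTheory Filter Topology

namespace RelStationary

/-! ### The group and the random walk -/

/-- The convolution powers `μ^{*k}` of a measure on a group, with `μ^{*0} = δ_1`. -/
noncomputable def convPow {G : Type*} [Group G] [MeasurableSpace G] (μ : Measure G) :
    ℕ → Measure G
  | 0 => Measure.dirac 1
  | k + 1 => Measure.mconv (convPow μ k) μ

/-- `μ` is admissible and non-degenerate: some convolution power of `μ` is absolutely continuous
with respect to Haar measure, and the support of `μ` generates `G` as a semigroup. -/
structure IsAdmissible {G : Type*} [Group G] [TopologicalSpace G] [IsTopologicalGroup G]
    [LocallyCompactSpace G] [MeasurableSpace G] [BorelSpace G] (μ : Measure G) : Prop where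
  exists_convPow_ac : ∃ k : ℕ, 1 ≤ k ∧ convPow μ k ≪ Measure.haar
  closure_support : Subsemigroup.closure (Measure.support μ) = ⊤

/-- The product measure `μ^ℕ` on the space of sequences `ω = (g₁, g₂, …)` (indexed from `0`). -/
noncomputable def seqMeasure {G : Type*} [MeasurableSpace G] (μ : Measure G)
    [IsProbabilityMeasure μ] : Measure (ℕ → G) :=
  Measure.infinitePi (fun _ : ℕ => μ)

/-- The product `g₁ g₂ ⋯ gₙ` of the first `n` entries of `ω`. -/
def walk {G : Type*} [Group G] (ω : ℕ → G) : ℕ → G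
  | 0 => 1
  | n + 1 => walk ω n * ω n

/-! ### Actions on products and on spaces of probability measures

Mathlib's `ProbabilityMeasure X` carries the weak* topology (weak convergence of measures) and the
σ-algebra generated by the evaluations at measurable sets. -/

instance instMeasurableConstSMulProd {G X Z : Type*} [Group G] [MeasurableSpace X]
    [MeasurableSpace Z] [MulAction G X] [MulAction G Z] [MeasurableConstSMul G X]
    [MeasurableConstSMul G Z] : MeasurableConstSMul G (X × Z) where
  measurable_const_smul g :=
    ((measurable_const_smul g).comp measurable_fst).prodMk
      ((measurable_const_smul g).comp measurable_snd)

/-- The push-forward action `(g • m)(A) = m(g⁻¹ A)` on probability measures. -/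
noncomputable instance instMulActionProbabilityMeasure {G X : Type*} [Group G] [MeasurableSpace X]
    [MulAction G X] [MeasurableConstSMul G X] : MulAction G (ProbabilityMeasure X) where
  smul g m := m.map (f := fun x => g • x) (measurable_const_smul g).aemeasurable
  one_smul m := by
    apply Subtype.ext
    change Measure.map (fun x => (1 : G) • x) (m : Measure X) = m
    simp
  mul_smul g h m := by
    apply Subtype.ext
    change Measure.map (fun x => (g * h) • x) (m : Measure X)
      = Measure.map (fun x => g • x) (Measure.map (fun x => h • x) (m : Measure X))
    rw [Measure.map_map (measurable_const_smul g) (measurable_const_smul h)]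
    simp [Function.comp_def, mul_smul]

theorem coe_smul {G X : Type*} [Group G] [MeasurableSpace X]
    [MulAction G X] [MeasurableConstSMul G X] (g : G) (m : ProbabilityMeasure X) :
    ((g • m : ProbabilityMeasure X) : Measure X) = (m : Measure X).map (fun x => g • x) := rfl

instance instMeasurableConstSMulProbabilityMeasure {G X : Type*} [Group G] [MeasurableSpace X]
    [MulAction G X] [MeasurableConstSMul G X] :
    MeasurableConstSMul G (ProbabilityMeasure X) where
  measurable_const_smul g :=
    Measurable.subtype_mk
      ((Measure.measurable_map _ (measurable_const_smul g)).comp measurable_subtype_coe)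

/-- On a compact metrizable space, weak* open sets of probability measures are measurable. -/
instance instOpensMeasurableSpaceProbabilityMeasure {X : Type*} [TopologicalSpace X]
    [CompactSpace X] [TopologicalSpace.MetrizableSpace X] [MeasurableSpace X] [BorelSpace X] :
    OpensMeasurableSpace (ProbabilityMeasure X) where
  borel_le := by
    let e : BoundedContinuousFunction X NNReal → ProbabilityMeasure X → NNReal :=
      fun f m => m.toFiniteMeasure.testAgainstNN f
    have hE : (inferInstance : TopologicalSpace (ProbabilityMeasure X)) =
        ⨅ f, TopologicalSpace.induced (e f) inferInstance := by
      have h : IsInducing (fun (m : ProbabilityMeasure X) (f : BoundedContinuousFunction X NNReal) =>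
          e f m) :=
        (IsInducing.mk rfl : IsInducing (fun (x : WeakDual NNReal
          (BoundedContinuousFunction X NNReal)) y => x y)).comp
          ((IsInducing.mk rfl : IsInducing (FiniteMeasure.toWeakDualBCNN (Ω := X))).comp
            (ProbabilityMeasure.toFiniteMeasure_isEmbedding X).isInducing)
      rw [h.eq_induced]
      simp only [Pi.topologicalSpace, induced_iInf, induced_compose]
      rfl
    have hG : (inferInstance : TopologicalSpace (ProbabilityMeasure X)) =
        TopologicalSpace.generateFrom (⋃ f, {u | ∃ U : Set NNReal, IsOpen U ∧ e f ⁻¹' U = u}) := by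
      rw [hE, generateFrom_iUnion]
      refine iInf_congr fun f => ?_
      exact (@TopologicalSpace.generateFrom_setOfPred_isOpen _ (TopologicalSpace.induced (e f) inferInstance)).symm
    have : SecondCountableTopology (ProbabilityMeasure X) := inferInstance
    rw [borel_eq_generateFrom_of_subbasis hG]
    refine MeasurableSpace.generateFrom_le ?_
    rintro _ hu
    obtain ⟨f, U, hU, rfl⟩ := Set.mem_iUnion.1 hu
    have hf : Measurable (e f) := by
      have h1 : Measurable fun m : ProbabilityMeasure X =>
          ∫⁻ x, (f x : ENNReal) ∂(m : Measure X) :=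
        (Measure.measurable_lintegral
          (measurable_coe_nnreal_ennreal_iff.2 f.continuous.measurable)).comp
            measurable_subtype_coe
      exact h1.ennreal_toNNReal
    exact hf hU.measurableSet

/-! ### Factor maps and disintegrations -/

section Factor

variable (G : Type*) {X Y : Type*} [Group G] [MeasurableSpace X] [MeasurableSpace Y]
  [MulAction G X] [MulAction G Y]

/-- The measure class of `ν` is preserved by the action. -/
def IsNonsingular (ν : Measure X) : Prop :=
  ∀ g : G, Measure.QuasiMeasurePreserving (fun x => g • x) ν ν

/-- A `G`-factor map `π : (X, ν) → (Y, η)` between nonsingular `G`-spaces: it pushes `ν` to `η`, and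
restricts to an equivariant map of a conull invariant measurable set `X₀` onto a conull
measurable set `Y₀`. Off `X₀` the values of `π` are irrelevant. -/
structure IsFactorMap (π : X → Y) (ν : Measure X) (η : Measure Y) : Prop where
  nonsingular_source : IsNonsingular G ν
  nonsingular_target : IsNonsingular G η
  measurable : Measurable π
  map_eq : ν.map π = η
  exists_conull : ∃ (X₀ : Set X) (Y₀ : Set Y), MeasurableSet X₀ ∧ MeasurableSet Y₀ ∧
    ν X₀ᶜ = 0 ∧ η Y₀ᶜ = 0 ∧ (∀ g : G, ∀ x ∈ X₀, g • x ∈ X₀) ∧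
    (∀ g : G, ∀ x ∈ X₀, π (g • x) = g • π x) ∧ π '' X₀ = Y₀

end Factor

/-- `y ↦ D y = ν_y` is a (version of the) disintegration of `ν` along
`π : (X, ν) → (Y, η)`; it is unique up to `η`-null sets. Since `η` is quasi-invariant for a factor
map, the almost everywhere conditions below do not depend on the version. -/
structure IsDisintegration {X Y : Type*} [MeasurableSpace X] [MeasurableSpace Y]
    (π : X → Y) (ν : Measure X) (η : Measure Y) (D : Y → ProbabilityMeasure X) : Prop where
  measurable : ∀ A : Set X, MeasurableSet A → Measurable fun y => (D y : Measure X) A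
  fibre : ∀ᵐ y ∂η, (D y : Measure X) (π ⁻¹' {y})ᶜ = 0
  integral : ∀ A : Set X, MeasurableSet A → ν A = ∫⁻ y, (D y : Measure X) A ∂η

/-- The translate `g ν_{g⁻¹ y}` of a family of measures `D y = ν_y`. -/
noncomputable def translate {G X Y : Type*} [Group G] [MeasurableSpace X] [MulAction G X]
    [MeasurableConstSMul G X] [MulAction G Y] (D : Y → ProbabilityMeasure X) (g : G) (y : Y) :
    ProbabilityMeasure X :=
  g • D (g⁻¹ • y)

section Notions

variable {G X Y Z : Type*} [Group G] [MeasurableSpace G] (μ : Measure G)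
  [MeasurableSpace X] [MulAction G X] [MeasurableConstSMul G X]
  [MeasurableSpace Y] [MulAction G Y]
  [MeasurableSpace Z] [MulAction G Z] [MeasurableConstSMul G Z]

variable (G) in
/-- `π` is relatively measure-preserving: `g ν_{g⁻¹ y} = ν_y` for almost all `y` and all `g`. -/
structure IsRelMeasurePreserving (π : X → Y) (ν : Measure X) (η : Measure Y) : Prop where
  factor : IsFactorMap G π ν η
  preserving : ∃ D : Y → ProbabilityMeasure X, IsDisintegration π ν η D ∧
    ∀ᵐ y ∂η, ∀ g : G, translate D g y = D y

/-- `π` is relatively `μ`-stationary: `ν_y = ∫ g ν_{g⁻¹ y} dμ(g)` for almost all `y`. -/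
structure IsRelStationary (π : X → Y) (ν : Measure X) (η : Measure Y) : Prop where
  factor : IsFactorMap G π ν η
  stationary : ∃ D : Y → ProbabilityMeasure X, IsDisintegration π ν η D ∧
    ∀ᵐ y ∂η, ∀ A : Set X, MeasurableSet A →
      (D y : Measure X) A = ∫⁻ g, (translate D g y : Measure X) A ∂μ

/-- `g₁ ⋯ gₙ ν_{gₙ⁻¹ ⋯ g₁⁻¹ y} → m` in the weak* topology, i.e. `ν_{y,ω}` exists and equals `m`. -/
def IsLimitMeasure [TopologicalSpace X] [OpensMeasurableSpace X] (D : Y → ProbabilityMeasure X)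
    (y : Y) (ω : ℕ → G) (m : ProbabilityMeasure X) : Prop :=
  Tendsto (fun n => translate D (walk ω n) y) atTop (𝓝 m)

variable [IsProbabilityMeasure μ]

/-- `π` is relatively proximal: almost every `ν_{y,ω}` exists and is a point mass. -/
structure IsRelProximal [TopologicalSpace X] [OpensMeasurableSpace X]
    (π : X → Y) (ν : Measure X) (η : Measure Y) : Prop where
  factor : IsFactorMap G π ν η
  proximal : ∃ D : Y → ProbabilityMeasure X, IsDisintegration π ν η D ∧
    ∀ᵐ y ∂η, ∀ᵐ ω ∂(seqMeasure μ), ∃ x : X, IsLimitMeasure D y ω (diracProba x)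

/-- A relative `μ`-boundary is a relatively `μ`-stationary, relatively proximal factor map. -/
structure IsRelBoundary [TopologicalSpace X] [OpensMeasurableSpace X]
    (π : X → Y) (ν : Measure X) (η : Measure Y) : Prop where
  stationary : IsRelStationary μ π ν η
  proximal : IsRelProximal μ π ν η

/-- `ρ` is a relative joining of `π₁ : (X, ν) → (Y, η)` and `π₂ : (Z, ζ) → (Y, η)`: the projections
are factor maps onto `(X, ν)` and `(Z, ζ)`, `π₁ ∘ pr₁ = π₂ ∘ pr₂` almost everywhere, and this map is
relatively `μ`-stationary. -/
structure IsRelJoining (π₁ : X → Y) (ν : Measure X) (π₂ : Z → Y) (ζ : Measure Z) (η : Measure Y)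
    (ρ : Measure (X × Z)) : Prop where
  stationary_left : IsRelStationary μ π₁ ν η
  stationary_right : IsRelStationary μ π₂ ζ η
  factor_fst : IsFactorMap G (Prod.fst : X × Z → X) ρ ν
  factor_snd : IsFactorMap G (Prod.snd : X × Z → Z) ρ ζ
  comm : ∀ᵐ p ∂ρ, π₁ p.1 = π₂ p.2
  stationary : IsRelStationary μ (fun p : X × Z => π₁ p.1) ρ η

/-- `ρ = ν ∨ ζ = ∫_Y ∫_{G^ℕ} ν_{y,ω} ⊗ ζ_{y,ω} dμ^ℕ(ω) dη(y)`. -/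
def IsJoin [TopologicalSpace X] [OpensMeasurableSpace X] [TopologicalSpace Z]
    [OpensMeasurableSpace Z] (π₁ : X → Y) (ν : Measure X) (π₂ : Z → Y) (ζ : Measure Z)
    (η : Measure Y) (ρ : Measure (X × Z)) : Prop :=
  ∃ (D₁ : Y → ProbabilityMeasure X) (D₂ : Y → ProbabilityMeasure Z)
    (L₁ : Y → (ℕ → G) → ProbabilityMeasure X) (L₂ : Y → (ℕ → G) → ProbabilityMeasure Z),
    IsDisintegration π₁ ν η D₁ ∧ IsDisintegration π₂ ζ η D₂ ∧
    Measurable (Function.uncurry L₁) ∧ Measurable (Function.uncurry L₂) ∧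
    (∀ᵐ y ∂η, ∀ᵐ ω ∂(seqMeasure μ), IsLimitMeasure D₁ y ω (L₁ y ω)) ∧
    (∀ᵐ y ∂η, ∀ᵐ ω ∂(seqMeasure μ), IsLimitMeasure D₂ y ω (L₂ y ω)) ∧
    ∀ A : Set (X × Z), MeasurableSet A →
      ρ A = ∫⁻ y, ∫⁻ ω, ((L₁ y ω : Measure X).prod (L₂ y ω : Measure Z)) A ∂(seqMeasure μ) ∂η

/-- `f : (X, ν) → (Z, ζ)` is relatively 1-1 in the limit over `(Y, η)`: for almost all `y` and `ω`,
`f` maps `ν_{y,ω}` to `ζ_{y,ω}` and is injective on a subset of `π₁⁻¹(y)` of full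
`ν_{y,ω}`-measure. -/
structure IsRelInjectiveInLimit [TopologicalSpace X] [OpensMeasurableSpace X] [TopologicalSpace Z]
    [OpensMeasurableSpace Z] (f : X → Z) (π₁ : X → Y) (ν : Measure X) (π₂ : Z → Y)
    (ζ : Measure Z) (η : Measure Y) : Prop where
  stationary_left : IsRelStationary μ π₁ ν η
  stationary_right : IsRelStationary μ π₂ ζ η
  factor : IsFactorMap G f ν ζ
  comm : ∀ᵐ x ∂ν, π₂ (f x) = π₁ x
  injective : ∃ (D₁ : Y → ProbabilityMeasure X) (D₂ : Y → ProbabilityMeasure Z),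
    IsDisintegration π₁ ν η D₁ ∧ IsDisintegration π₂ ζ η D₂ ∧
    ∀ᵐ y ∂η, ∀ᵐ ω ∂(seqMeasure μ), ∃ (m₁ : ProbabilityMeasure X) (m₂ : ProbabilityMeasure Z),
      IsLimitMeasure D₁ y ω m₁ ∧ IsLimitMeasure D₂ y ω m₂ ∧
      (m₂ : Measure Z) = (m₁ : Measure X).map f ∧
      ∃ S : Set X, S ⊆ π₁ ⁻¹' {y} ∧ MeasurableSet S ∧ (m₁ : Measure X) Sᶜ = 0 ∧ Set.InjOn f S

end Notions

end RelStationary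

namespace RelStationary

/-! ### Measurability and topology of spaces of probability measures -/

/-! Fix a disintegration `D` of `ν` over `η`. For continuous `f`, the integrals of `f` against `g₁ ⋯
gₙ D (gₙ⁻¹ ⋯ g₁⁻¹ y)` form a bounded martingale in `ω`. Hence the limits `L y ω` exist almost surely
(`ae_ae_exists_isLimitMeasure`) and average back to `D y` (`average_limitMeasure`). They are
equivariant under restarting the walk after `n` steps (`isEquivariantFamily_limitMeasure`).

Conversely, let `K y ω` be any measurable family of random measures equivariant in this sense. Its
averages over `ω` form a stationary family (`IsEquivariantFamily.isStationaryFamily`), and by Lévy's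
upward theorem the limits of that family along the walk are the `K y ω` themselves
(`IsEquivariantFamily.isLimitMeasure`).

This is applied to two families built from `L`. The point masses `δ_L` average to the disintegration
of `ξ`, the law of `L`; their limits are point masses, so `ξ` is a boundary. The products `L ⊗ δ_L`
average to the disintegration of the joining `ρ`; its limits live on slices `X × {L y ω}`, where the
first projection is injective. Over `ξ`, the fibre measure of `ρ` at `m` is `m ⊗ δ_m`, which is
visibly equivariant, so the second projection is relatively measure-preserving.

The map `φ` to `Y` reads off the fibre of `π` carrying a measure (`exists_measurable_fibreMap`); it
is meaningful `ξ`-almost everywhere because `D y`, and hence almost every `L y ω`, lives on `π⁻¹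
{y}`. Admissibility of `μ` enters only through the quasi-invariance of `ξ` and `ρ`
(`IsStationaryFamily.isNonsingular`). -/

theorem measurable_probabilityMeasure_iff {Ω W : Type*} [MeasurableSpace Ω] [MeasurableSpace W]
    {K : Ω → ProbabilityMeasure W} :
    Measurable K ↔ ∀ A, MeasurableSet A → Measurable fun ω => (K ω : Measure W) A := by
  constructor
  · intro h A hA
    exact (Measure.measurable_coe hA).comp (measurable_subtype_coe.comp h)
  · intro h
    exact Measurable.subtype_mk (Measure.measurable_of_measurable_coe _ h)

theorem measurable_coe_probabilityMeasure {W : Type*} [MeasurableSpace W] :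
    Measurable fun m : ProbabilityMeasure W => (m : Measure W) :=
  measurable_subtype_coe

/-- The tautological Markov kernel. -/
noncomputable def evalKernel (W : Type*) [MeasurableSpace W] :
    ProbabilityTheory.Kernel (ProbabilityMeasure W) W :=
  ⟨fun m => (m : Measure W), measurable_coe_probabilityMeasure⟩

instance {W : Type*} [MeasurableSpace W] : ProbabilityTheory.IsMarkovKernel (evalKernel W) :=
  ⟨fun m => inferInstanceAs (IsProbabilityMeasure (m : Measure W))⟩

theorem measurable_section_probabilityMeasure {Ω W : Type*} [MeasurableSpace Ω]
    [MeasurableSpace W] {K : Ω → ProbabilityMeasure W} (hK : Measurable K) {s : Set (Ω × W)}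
    (hs : MeasurableSet s) :
    Measurable fun ω => (K ω : Measure W) {x | (ω, x) ∈ s} :=
  ProbabilityTheory.Kernel.measurable_kernel_prodMk_left (κ := (evalKernel W).comap K hK) hs

theorem measurable_diracProba {W : Type*} [MeasurableSpace W] :
    Measurable (diracProba : W → ProbabilityMeasure W) :=
  Measurable.subtype_mk Measure.measurable_dirac

theorem measurable_probabilityMeasure_prod {Ω W V : Type*} [MeasurableSpace Ω]
    [MeasurableSpace W] [MeasurableSpace V] {K : Ω → ProbabilityMeasure W}
    {L : Ω → ProbabilityMeasure V} (hK : Measurable K) (hL : Measurable L) :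
    Measurable fun ω => (K ω).prod (L ω) :=
  Measurable.subtype_mk (ProbabilityMeasure.measurable_fun_prod.comp (hK.prodMk hL))

theorem measurableSMul₂_probabilityMeasure {G W : Type*} [Group G] [MeasurableSpace G]
    [MeasurableSpace W] [MulAction G W] [MeasurableSMul₂ G W] :
    MeasurableSMul₂ G (ProbabilityMeasure W) where
  measurable_smul := by
    rw [measurable_probabilityMeasure_iff]
    intro A hA
    have h : ∀ p : G × ProbabilityMeasure W, ((p.1 • p.2 : ProbabilityMeasure W) : Measure W) A
        = (p.2 : Measure W) {x | (p, x) ∈ (fun q : (G × ProbabilityMeasure W) × W =>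
          q.1.1 • q.2) ⁻¹' A} := by
      intro p
      rw [coe_smul, Measure.map_apply (measurable_const_smul p.1) hA]
      rfl
    refine Eq.subst (motive := fun f => Measurable f) (funext h).symm ?_
    exact measurable_section_probabilityMeasure measurable_snd
      (((measurable_fst.comp measurable_fst).smul measurable_snd) hA)

attribute [local instance] measurableSMul₂_probabilityMeasure

theorem measurableSMul₂_prod {G W V : Type*} [Group G] [MeasurableSpace G]
    [MeasurableSpace W] [MulAction G W] [MeasurableSMul₂ G W]
    [MeasurableSpace V] [MulAction G V] [MeasurableSMul₂ G V] :
    MeasurableSMul₂ G (W × V) where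
  measurable_smul :=
    (measurable_fst.smul (measurable_fst.comp measurable_snd)).prodMk
      (measurable_fst.smul (measurable_snd.comp measurable_snd))

attribute [local instance] measurableSMul₂_prod

/-- Evaluation at a closed set is a pointwise limit of integrals of thickened indicators, which are
weak* continuous, and closed sets form a generating π-system. This allows `ProbabilityMeasure X`
itself to play the role of the compact space in the limit theorems. -/
theorem borelSpace_probabilityMeasure {W : Type*} [TopologicalSpace W]
    [CompactSpace W] [TopologicalSpace.MetrizableSpace W] [MeasurableSpace W] [BorelSpace W] :
    BorelSpace (ProbabilityMeasure W) where
  measurable_eq := by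
    refine le_antisymm ?_ (OpensMeasurableSpace.borel_le)
    let := TopologicalSpace.metrizableSpaceMetric W
    suffices h : ∀ A : Set W, MeasurableSet A →
        Measurable[borel (ProbabilityMeasure W)] fun m : ProbabilityMeasure W =>
          (m : Measure W) A by
      have := @measurable_probabilityMeasure_iff (ProbabilityMeasure W) W
        (borel (ProbabilityMeasure W)) _ id
      exact fun s hs => (this.2 h) hs
    let mB : MeasurableSpace (ProbabilityMeasure W) := borel (ProbabilityMeasure W)
    have : BorelSpace (ProbabilityMeasure W) := ⟨rfl⟩
    have hF : ∀ F : Set W, IsClosed F →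
        Measurable fun m : ProbabilityMeasure W => (m : Measure W) F := by
      intro F hF
      refine measurable_of_tendsto_metrizable (f := fun (n : ℕ) (m : ProbabilityMeasure W) =>
        ∫⁻ x, (thickenedIndicator (δ := 1 / ((n : ℝ) + 1)) Nat.one_div_pos_of_nat F x : ENNReal)
          ∂(m : Measure W)) ?_ ?_
      · intro n
        exact (ProbabilityMeasure.continuous_lintegral_boundedContinuousFunction _).measurable
      · rw [tendsto_pi_nhds]
        intro m
        exact tendsto_lintegral_thickenedIndicator_of_isClosed (m : Measure W) hF _
          tendsto_one_div_add_atTop_nhds_zero_nat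
    have hm := Measurable.measure_of_isPiSystem_of_isProbabilityMeasure
      (μ := fun m : ProbabilityMeasure W => (m : Measure W))
      (S := {F : Set W | IsClosed F})
      (by rw [BorelSpace.measurable_eq (α := W), borel_eq_generateFrom_isClosed])
      isPiSystem_isClosed hF
    exact fun A hA => (Measure.measurable_coe hA).comp hm

attribute [local instance] borelSpace_probabilityMeasure

theorem polishSpace_probabilityMeasure {W : Type*} [TopologicalSpace W]
    [CompactSpace W] [TopologicalSpace.MetrizableSpace W] [MeasurableSpace W] [BorelSpace W] :
    PolishSpace (ProbabilityMeasure W) := by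
  let := TopologicalSpace.metrizableSpaceMetric (ProbabilityMeasure W)
  infer_instance

attribute [local instance] polishSpace_probabilityMeasure

/-- Weak convergence on a compact metrizable space is tested on countably many functions. -/
theorem exists_countable_tendsto {W : Type*} [TopologicalSpace W]
    [CompactSpace W] [TopologicalSpace.MetrizableSpace W] [MeasurableSpace W] [BorelSpace W] :
    ∃ S : ℕ → C(W, ℝ), ∀ (u : ℕ → ProbabilityMeasure W) (m : ProbabilityMeasure W),
      (∀ i, Tendsto (fun n => ∫ x, S i x ∂(u n : Measure W)) atTop
        (𝓝 (∫ x, S i x ∂(m : Measure W)))) → Tendsto u atTop (𝓝 m) := by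
  refine ⟨TopologicalSpace.denseSeq C(W, ℝ), fun u m h => ?_⟩
  rw [ProbabilityMeasure.tendsto_iff_forall_integral_tendsto]
  intro f
  have hint : ∀ (g : C(W, ℝ)) (p : ProbabilityMeasure W), Integrable g (p : Measure W) :=
    fun g p => (BoundedContinuousFunction.mkOfCompact g).integrable _
  let F : C(W, ℝ) := f
  have hd : ∀ (i : ℕ) (p : ProbabilityMeasure W),
      |(∫ x, f x ∂(p : Measure W)) - ∫ x, TopologicalSpace.denseSeq C(W, ℝ) i x ∂(p : Measure W)|
        ≤ dist F (TopologicalSpace.denseSeq C(W, ℝ) i) := by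
    intro i p
    change |(∫ x, F x ∂(p : Measure W)) - _| ≤ _
    rw [← integral_sub (hint _ _) (hint _ _)]
    refine (norm_integral_le_of_norm_le_const (G := ℝ) (μ := (p : Measure W))
      (C := dist F (TopologicalSpace.denseSeq C(W, ℝ) i)) (ae_of_all _ fun x => ?_)).trans ?_
    · rw [← dist_eq_norm]
      exact ContinuousMap.dist_apply_le_dist x
    · simp
  rw [Metric.tendsto_atTop]
  intro ε hε
  obtain ⟨i, hi⟩ := (TopologicalSpace.denseRange_denseSeq C(W, ℝ)).exists_dist_lt F
    (show 0 < ε / 3 by positivity)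
  obtain ⟨N, hN⟩ := Metric.tendsto_atTop.1 (h i) (ε / 3) (by positivity)
  refine ⟨N, fun n hn => ?_⟩
  have h1 := hd i (u n)
  have h2 := hd i m
  have h3 := hN n hn
  rw [Real.dist_eq] at h3 ⊢
  rw [abs_le] at h1 h2
  rw [abs_lt] at h3 ⊢
  constructor <;> linarith [h1.1, h1.2, h2.1, h2.2, h3.1, h3.2]

/-- By compactness, it is enough to check convergence of the integrals of countably many functions
for a weak limit to exist. -/
theorem exists_countable_exists_tendsto {W : Type*} [TopologicalSpace W]
    [CompactSpace W] [TopologicalSpace.MetrizableSpace W] [MeasurableSpace W] [BorelSpace W] :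
    ∃ S : ℕ → C(W, ℝ), ∀ u : ℕ → ProbabilityMeasure W,
      (∀ i, ∃ c, Tendsto (fun n => ∫ x, S i x ∂(u n : Measure W)) atTop (𝓝 c)) →
        ∃ m, Tendsto u atTop (𝓝 m) := by
  obtain ⟨S, hS⟩ := exists_countable_tendsto (W := W)
  refine ⟨S, fun u h => ?_⟩
  obtain ⟨m, φ, hφ, hm⟩ := CompactSpace.tendsto_subseq u
  refine ⟨m, hS u m fun i => ?_⟩
  obtain ⟨c, hc⟩ := h i
  have h1 := hc.comp hφ.tendsto_atTop
  have h2 := (ProbabilityMeasure.tendsto_iff_forall_integral_tendsto.1 hm)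
    (BoundedContinuousFunction.mkOfCompact (S i))
  have h3 : c = ∫ x, S i x ∂(m : Measure W) := tendsto_nhds_unique h1 h2
  rwa [h3] at hc

theorem measurable_integral_continuousMap {W : Type*} [TopologicalSpace W]
    [CompactSpace W] [TopologicalSpace.MetrizableSpace W] [MeasurableSpace W] [BorelSpace W]
    (f : C(W, ℝ)) : Measurable fun m : ProbabilityMeasure W => ∫ x, f x ∂(m : Measure W) :=
  (ProbabilityMeasure.continuous_integral_continuousMap f).measurable

/-! ### Averages of random probability measures -/

/-- The average `∫ K y ω dP(ω)` of a random family of probability measures. -/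
noncomputable def average {Y Ω W : Type*} [MeasurableSpace Y] [MeasurableSpace Ω]
    [MeasurableSpace W] (P : Measure Ω) [IsProbabilityMeasure P]
    (K : Y → Ω → ProbabilityMeasure W) (hK : Measurable (Function.uncurry K)) (y : Y) :
    ProbabilityMeasure W :=
  ⟨P.bind fun ω => (K y ω : Measure W), isProbabilityMeasure_bind
    (measurable_coe_probabilityMeasure.comp (hK.comp measurable_prodMk_left)).aemeasurable
    (ae_of_all _ fun _ => inferInstance)⟩

section Average

variable {Y Ω W : Type*} [MeasurableSpace Y] [MeasurableSpace Ω] [MeasurableSpace W]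
  (P : Measure Ω) [IsProbabilityMeasure P] {K : Y → Ω → ProbabilityMeasure W}
  (hK : Measurable (Function.uncurry K))

theorem average_apply (y : Y) {A : Set W} (hA : MeasurableSet A) :
    (average P K hK y : Measure W) A = ∫⁻ ω, (K y ω : Measure W) A ∂P :=
  Measure.bind_apply hA
    (measurable_coe_probabilityMeasure.comp (hK.comp measurable_prodMk_left)).aemeasurable

theorem lintegral_average (y : Y) {f : W → ENNReal} (hf : Measurable f) :
    ∫⁻ x, f x ∂(average P K hK y : Measure W) = ∫⁻ ω, ∫⁻ x, f x ∂(K y ω : Measure W) ∂P :=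
  Measure.lintegral_bind
    (measurable_coe_probabilityMeasure.comp (hK.comp measurable_prodMk_left)).aemeasurable
    hf.aemeasurable

theorem integral_average (y : Y) {f : W → ℝ} (hf : Measurable f) {C : ℝ} (hC : ∀ x, |f x| ≤ C) :
    ∫ x, f x ∂(average P K hK y : Measure W) = ∫ ω, ∫ x, f x ∂(K y ω : Measure W) ∂P := by
  let κ : ProbabilityTheory.Kernel Ω W := (evalKernel W).comap (K y)
    (hK.comp measurable_prodMk_left)
  have h : (average P K hK y : Measure W)
      = (κ.comp (ProbabilityTheory.Kernel.const Unit P)) () := by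
    rw [ProbabilityTheory.Kernel.comp_apply, ProbabilityTheory.Kernel.const_apply]
    rfl
  rw [h, ProbabilityTheory.Kernel.integral_comp]
  · rfl
  · rw [← h]
    exact Integrable.of_bound hf.aestronglyMeasurable C (ae_of_all _ hC)

theorem measurable_average : Measurable (average P K hK) := by
  rw [measurable_probabilityMeasure_iff]
  intro A hA
  simp only [average_apply P hK _ hA]
  exact (measurable_probabilityMeasure_iff.1 hK A hA).lintegral_prod_right'

theorem measurable_coe_average : Measurable fun y => (average P K hK y : Measure W) :=
  measurable_coe_probabilityMeasure.comp (measurable_average P hK)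

end Average

/-! ### Sequences of increments -/

/-- The sequence whose first `n` entries are those of `ω`, followed by the entries of `ω'`. -/
def concat {G : Type*} (n : ℕ) (ω ω' : ℕ → G) : ℕ → G :=
  fun i => if i < n then ω i else ω' (i - n)

/-- Replace all entries of a sequence but the first `n` ones by `1`. -/
def trunc {G : Type*} [One G] (n : ℕ) (ω : ℕ → G) : ℕ → G :=
  fun i => if i < n then ω i else 1

section Algebra

variable {G : Type*} [Group G]

theorem trunc_trunc {m n : ℕ} (h : m ≤ n) (ω : ℕ → G) : trunc m (trunc n ω) = trunc m ω := by
  funext i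
  simp only [trunc]
  split_ifs <;> first | rfl | omega

theorem trunc_concat (n : ℕ) (ω ω' : ℕ → G) : trunc n (concat n ω ω') = trunc n ω := by
  funext i
  simp only [trunc, concat]
  split_ifs <;> rfl

theorem concat_trunc (n : ℕ) (ω ω' : ℕ → G) : concat n (trunc n ω) ω' = concat n ω ω' := by
  funext i
  simp only [trunc, concat]
  split_ifs <;> rfl

theorem walk_trunc {m n : ℕ} (h : m ≤ n) (ω : ℕ → G) : walk (trunc n ω) m = walk ω m := by
  induction m with
  | zero => rfl
  | succ m ih =>
    rw [walk, walk, ih (by omega), trunc, if_pos (by omega)]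

/-- After `n` steps the walk restarts from `walk ω n` with fresh increments `ω'`; the martingale
identity and the equivariance of the limits both come from this. -/
theorem walk_concat_add (n k : ℕ) (ω ω' : ℕ → G) :
    walk (concat n ω ω') (n + k) = walk ω n * walk ω' k := by
  induction k with
  | zero =>
    have := walk_trunc (le_refl n) (concat n ω ω')
    rw [trunc_concat, walk_trunc le_rfl] at this
    simp only [add_zero, walk, mul_one, this]
  | succ k ih =>
    rw [← add_assoc, walk, walk, ih, ← mul_assoc, concat, if_neg (by omega)]
    congr 2
    omega

end Algebra

theorem measurable_concat {G : Type*} [MeasurableSpace G] (n : ℕ) :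
    Measurable fun p : (ℕ → G) × (ℕ → G) => concat n p.1 p.2 := by
  refine measurable_pi_lambda _ fun i => ?_
  by_cases h : i < n
  · simpa [concat, h] using show Measurable fun p : (ℕ → G) × (ℕ → G) => p.1 i by fun_prop
  · simpa [concat, h] using show Measurable fun p : (ℕ → G) × (ℕ → G) => p.2 (i - n) by fun_prop

section Measurability

variable {G : Type*} [Group G] [MeasurableSpace G]

theorem measurable_walk [MeasurableMul₂ G] (n : ℕ) : Measurable fun ω : ℕ → G => walk ω n := by
  induction n with
  | zero => exact measurable_const
  | succ n ih => exact ih.mul (measurable_pi_apply n)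

theorem measurable_trunc (n : ℕ) : Measurable (trunc n : (ℕ → G) → ℕ → G) := by
  refine measurable_pi_lambda _ fun i => ?_
  by_cases h : i < n
  · simpa [trunc, h] using measurable_pi_apply i
  · simp [trunc, h]

/-- The filtration of the first `n` increments. -/
def incrementFiltration (G : Type*) [Group G] [MeasurableSpace G] :
    Filtration ℕ (inferInstance : MeasurableSpace (ℕ → G)) where
  seq n := MeasurableSpace.comap (trunc n) inferInstance
  mono' m n h := by
    rintro _ ⟨t, ht, rfl⟩
    refine ⟨trunc m ⁻¹' t, measurable_trunc m ht, ?_⟩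
    ext ω
    simp [trunc_trunc h]
  le' n := (measurable_trunc n).comap_le

theorem iSup_incrementFiltration :
    ⨆ n, incrementFiltration G n = (inferInstance : MeasurableSpace (ℕ → G)) := by
  refine le_antisymm (iSup_le fun n => (incrementFiltration G).le n) ?_
  refine iSup_le fun i => ?_
  -- Entries are indexed from `0`, so entry `i` survives truncation only from length `i + 1` on.
  refine le_trans ?_ (le_iSup _ (i + 1))
  rintro _ ⟨t, ht, rfl⟩
  refine ⟨(fun ω => ω i) ⁻¹' t, measurable_pi_apply i ht, ?_⟩
  ext ω
  simp [trunc]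

theorem stronglyMeasurable_incrementFiltration {n : ℕ} {f : (ℕ → G) → ℝ} (hf : Measurable f)
    (h : ∀ ω, f (trunc n ω) = f ω) : StronglyMeasurable[incrementFiltration G n] f := by
  have : f = f ∘ trunc n := funext fun ω => (h ω).symm
  rw [this]
  exact (hf.comp (comap_measurable (trunc n))).stronglyMeasurable

variable (μ : Measure G) [IsProbabilityMeasure μ]

instance : IsProbabilityMeasure (seqMeasure μ) :=
  inferInstanceAs (IsProbabilityMeasure (Measure.infinitePi _))

omit [Group G] in
theorem measurePreserving_eval_seqMeasure (i : ℕ) :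
    MeasurePreserving (fun ω : ℕ → G => ω i) (seqMeasure μ) μ :=
  measurePreserving_eval_infinitePi (fun _ => μ) i

omit [Group G] in
-- Past and future increments are independent, and the future has the law of the whole sequence. On
-- cylinders, the constraints split into those with index below `n` and the remaining ones shifted
-- down by `n`.
theorem measurePreserving_concat (n : ℕ) :
    MeasurePreserving (fun p : (ℕ → G) × (ℕ → G) => concat n p.1 p.2)
      ((seqMeasure μ).prod (seqMeasure μ)) (seqMeasure μ) := by
  classical
  refine ⟨measurable_concat n, ?_⟩
  refine Measure.eq_infinitePi _ fun s t ht => ?_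
  rw [Measure.map_apply (measurable_concat n)
    (MeasurableSet.pi s.countable_toSet fun i _ => ht i)]
  have hpre : (fun p : (ℕ → G) × (ℕ → G) => concat n p.1 p.2) ⁻¹' (Set.pi s t)
      = (Set.pi (s.filter (· < n) : Finset ℕ) t) ×ˢ
        (Set.pi ((s.filter (fun i => ¬ i < n)).image (· - n) : Finset ℕ) fun j => t (j + n)) := by
    ext p
    simp only [Set.mem_preimage, Set.mem_pi, Set.mem_prod, Finset.mem_coe, Finset.mem_filter,
      Finset.mem_image, concat]
    constructor
    · intro h
      refine ⟨fun i hi => by simpa [hi.2] using h i hi.1, ?_⟩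
      rintro _ ⟨i, ⟨hi, hin⟩, rfl⟩
      have := h i hi
      rw [if_neg hin] at this
      rwa [Nat.sub_add_cancel (by omega)]
    · rintro ⟨h1, h2⟩ i hi
      split_ifs with hin
      · exact h1 i ⟨hi, hin⟩
      · have := h2 (i - n) ⟨i, ⟨hi, hin⟩, rfl⟩
        rwa [Nat.sub_add_cancel (by omega)] at this
  rw [hpre, Measure.prod_prod, seqMeasure, Measure.infinitePi_pi _ fun i _ => ht i,
    Measure.infinitePi_pi _ fun i _ => ht _, Finset.prod_image,
    ← Finset.prod_filter_mul_prod_filter_not s (· < n)]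
  · congr 1
    refine Finset.prod_congr rfl fun i hi => ?_
    have := (Finset.mem_filter.1 hi).2
    rw [Nat.sub_add_cancel (by omega)]
  · intro i hi j hj hij
    have := (Finset.mem_filter.1 hi).2
    have := (Finset.mem_filter.1 hj).2
    simp only at hij
    omega

/-- Conditioning on the first `n` increments means resampling the others. A set of the filtration
does not see the resampled entries, so its indicator comes out of the inner integral after
`measurePreserving_concat` and Fubini. -/
theorem condExp_incrementFiltration (n : ℕ) {H : (ℕ → G) → ℝ} (hH : Measurable H) {C : ℝ}
    (hC : ∀ ω, |H ω| ≤ C) :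
    (fun ω => ∫ ω', H (concat n ω ω') ∂(seqMeasure μ))
      =ᵐ[seqMeasure μ] (seqMeasure μ)[H | incrementFiltration G n] := by
  have hm : Measurable fun p : (ℕ → G) × (ℕ → G) => H (concat n p.1 p.2) :=
    hH.comp (measurable_concat n)
  have hm' : Measurable fun ω => ∫ ω', H (concat n ω ω') ∂(seqMeasure μ) :=
    hm.stronglyMeasurable.integral_prod_right.measurable
  have hb : ∀ ω, |∫ ω', H (concat n ω ω') ∂(seqMeasure μ)| ≤ C := fun ω => by
    refine (norm_integral_le_of_norm_le_const (G := ℝ) (C := C) (μ := seqMeasure μ)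
      (ae_of_all _ fun ω' => hC _)).trans ?_
    simp
  refine ae_eq_condExp_of_forall_setIntegral_eq ((incrementFiltration G).le n)
    (Integrable.of_bound hH.aestronglyMeasurable C (ae_of_all _ hC))
    (fun s _ _ => (Integrable.of_bound hm'.aestronglyMeasurable C (ae_of_all _ hb)).integrableOn)
    ?_ (stronglyMeasurable_incrementFiltration hm' fun ω => by
      simp only [concat_trunc]).aestronglyMeasurable
  rintro s ⟨t, ht, rfl⟩ -
  have hs : MeasurableSet (trunc n ⁻¹' t : Set (ℕ → G)) := measurable_trunc n ht
  rw [← integral_indicator hs, ← integral_indicator hs]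
  have hmp := measurePreserving_concat μ n
  rw [← hmp.map_eq, integral_map hmp.measurable.aemeasurable
    (hH.indicator hs).aestronglyMeasurable, hmp.map_eq, integral_prod]
  · refine integral_congr_ae (ae_of_all _ fun ω => ?_)
    have hmem : ∀ ω', concat n ω ω' ∈ trunc n ⁻¹' t ↔ ω ∈ trunc n ⁻¹' t := fun ω' => by
      simp only [Set.mem_preimage, trunc_concat]
    by_cases h : ω ∈ trunc n ⁻¹' t <;> simp [Set.indicator, hmem, h]
  · refine Integrable.of_bound (C := C)
      ((hH.indicator hs).comp (measurable_concat n)).aestronglyMeasurable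
      (ae_of_all _ fun p => ?_)
    refine le_trans ?_ (hC (concat n p.1 p.2))
    simp only [Set.indicator]
    split_ifs
    · exact le_rfl
    · simp

/-- Lévy's upward theorem for the increments of the random walk. -/
theorem tendsto_integral_concat {H : (ℕ → G) → ℝ} (hH : Measurable H) {C : ℝ}
    (hC : ∀ ω, |H ω| ≤ C) :
    ∀ᵐ ω ∂(seqMeasure μ), Tendsto (fun n => ∫ ω', H (concat n ω ω') ∂(seqMeasure μ)) atTop
      (𝓝 (H ω)) := by
  have h1 := ae_all_iff.2 fun n => condExp_incrementFiltration μ n hH hC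
  have h2 := Integrable.tendsto_ae_condExp (μ := seqMeasure μ) (ℱ := incrementFiltration G)
    (Integrable.of_bound hH.aestronglyMeasurable C (ae_of_all _ hC))
    (by rw [iSup_incrementFiltration]; exact hH.stronglyMeasurable)
  filter_upwards [h1, h2] with ω h1 h2
  exact h2.congr fun n => (h1 n).symm

/-- Bounded martingales for the increments of the random walk converge. -/
theorem exists_tendsto_of_integral_concat {u : ℕ → (ℕ → G) → ℝ} (hu : ∀ n, Measurable (u n))
    {C : ℝ} (hC : ∀ n ω, |u n ω| ≤ C) (htr : ∀ n ω, u n (trunc n ω) = u n ω)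
    (hmart : ∀ n, ∀ᵐ ω ∂(seqMeasure μ),
      u n ω = ∫ ω', u (n + 1) (concat n ω ω') ∂(seqMeasure μ)) :
    ∀ᵐ ω ∂(seqMeasure μ), ∃ c, Tendsto (fun n => u n ω) atTop (𝓝 c) := by
  have hint : ∀ n, Integrable (u n) (seqMeasure μ) := fun n =>
    Integrable.of_bound (hu n).aestronglyMeasurable C (ae_of_all _ (hC n))
  have hM : Martingale u (incrementFiltration G) (seqMeasure μ) :=
    martingale_nat (fun n => stronglyMeasurable_incrementFiltration (hu n) (htr n)) hint
      fun n => EventuallyEq.trans (hmart n) (condExp_incrementFiltration μ n (hu (n + 1)) (hC (n + 1)))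
  refine hM.submartingale.exists_ae_tendsto_of_bdd (R := C.toNNReal) fun n => ?_
  refine (eLpNorm_le_of_ae_bound (C := C) (ae_of_all _ (hC n))).trans ?_
  simp [ENNReal.ofReal]

end Measurability

/-! ### Translates of families of measures -/

section Translate

variable {G W Y : Type*} [Group G] [MeasurableSpace W] [MulAction G W] [MeasurableConstSMul G W]
  [MulAction G Y]

theorem smul_apply (g : G) (m : ProbabilityMeasure W) {A : Set W} (hA : MeasurableSet A) :
    ((g • m : ProbabilityMeasure W) : Measure W) A = (m : Measure W) ((fun x => g • x) ⁻¹' A) := by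
  rw [coe_smul, Measure.map_apply (measurable_const_smul g) hA]

theorem integral_smul_probabilityMeasure (g : G) (m : ProbabilityMeasure W) {f : W → ℝ}
    (hf : Measurable f) :
    ∫ x, f x ∂((g • m : ProbabilityMeasure W) : Measure W) = ∫ x, f (g • x) ∂(m : Measure W) := by
  rw [coe_smul, integral_map (measurable_const_smul g).aemeasurable hf.aestronglyMeasurable]

theorem translate_mul (D : Y → ProbabilityMeasure W) (g h : G) (y : Y) :
    translate D (g * h) y = g • translate D h (g⁻¹ • y) := by
  simp only [translate, mul_smul, mul_inv_rev]

theorem translate_one (D : Y → ProbabilityMeasure W) (y : Y) : translate D (1 : G) y = D y := by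
  simp [translate]

theorem smul_diracProba (g : G) (x : W) : g • diracProba x = diracProba (g • x) := by
  apply Subtype.ext
  change Measure.map (fun x => g • x) (Measure.dirac x) = Measure.dirac (g • x)
  rw [Measure.map_dirac' (measurable_const_smul g)]

theorem smul_prod {V : Type*} [MeasurableSpace V] [MulAction G V] [MeasurableConstSMul G V] (g : G)
    (m : ProbabilityMeasure W) (m' : ProbabilityMeasure V) :
    g • m.prod m' = (g • m).prod (g • m') := by
  apply Subtype.ext
  change Measure.map (fun x => g • x) ((m : Measure W).prod (m' : Measure V))
    = (Measure.map (fun x => g • x) (m : Measure W)).prod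
      (Measure.map (fun x => g • x) (m' : Measure V))
  rw [Measure.map_prod_map _ _ (measurable_const_smul g) (measurable_const_smul g)]
  rfl

theorem continuous_smul_probabilityMeasure [TopologicalSpace W] [OpensMeasurableSpace W]
    [BorelSpace W] [ContinuousConstSMul G W] (g : G) :
    Continuous fun m : ProbabilityMeasure W => g • m :=
  ProbabilityMeasure.continuous_map (continuous_const_smul g)

end Translate

section Family

variable {G W Y : Type*} [Group G] [MeasurableSpace G] [MeasurableInv G] [MeasurableSpace W]
  [MulAction G W] [MeasurableSMul₂ G W] [MeasurableSpace Y] [MulAction G Y] [MeasurableSMul₂ G Y]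

theorem measurable_translate {D : Y → ProbabilityMeasure W} (hD : Measurable D) :
    Measurable (Function.uncurry fun (y : Y) (g : G) => translate D g y) :=
  measurable_snd.smul (hD.comp (measurable_snd.inv.smul measurable_fst))

theorem measurable_translate_apply {D : Y → ProbabilityMeasure W} (hD : Measurable D) (y : Y)
    {A : Set W} (hA : MeasurableSet A) :
    Measurable fun g : G => (translate D g y : Measure W) A :=
  measurable_probabilityMeasure_iff.1 ((measurable_translate hD).comp measurable_prodMk_left) A hA

/-- If `η` is quasi-invariant, a property that holds almost everywhere holds at almost all
translates of almost all points. -/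
theorem ae_ae_inv_smul {η : Measure Y} [SFinite η] (hη : IsNonsingular G η) {Ω : Type*}
    [MeasurableSpace Ω] (P : Measure Ω) [SFinite P] {a : Ω → G} (ha : Measurable a) {p : Y → Prop}
    (hp : ∀ᵐ y ∂η, p y) : ∀ᵐ y ∂η, ∀ᵐ ω ∂P, p ((a ω)⁻¹ • y) := by
  -- The exchange of the two quantifiers is a Fubini argument and needs a measurable exceptional
  -- set, while `p` is arbitrary.
  obtain ⟨s, hps, hs, hs0⟩ := exists_measurable_superset_of_null (ae_iff.1 hp)
  have h : ∀ᵐ y ∂η, ∀ᵐ ω ∂P, (a ω)⁻¹ • y ∉ s := by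
    rw [Measure.ae_ae_comm (μ := η) (ν := P) (p := fun y ω => (a ω)⁻¹ • y ∉ s)]
    · refine ae_of_all _ fun ω => (hη (a ω)⁻¹).ae (p := fun y => y ∉ s) ?_
      rw [ae_iff]
      simpa using hs0
    · exact ((ha.comp measurable_snd).inv.smul measurable_fst) hs.compl
  filter_upwards [h] with y hy
  filter_upwards [hy] with ω hω
  by_contra hn
  exact hω (hps hn)

/-- The family `D` is stationary: `D y = ∫ g D (g⁻¹ y) dμ(g)` for almost all `y`. -/
def IsStationaryFamily (μ : Measure G) (η : Measure Y) (D : Y → ProbabilityMeasure W) : Prop :=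
  ∀ᵐ y ∂η, ∀ A : Set W, MeasurableSet A →
    (D y : Measure W) A = ∫⁻ g, (translate D g y : Measure W) A ∂μ

theorem integral_eq_of_stationary {μ : Measure G} [IsProbabilityMeasure μ]
    {D : Y → ProbabilityMeasure W} (hD : Measurable D) {y : Y}
    (hy : ∀ A : Set W, MeasurableSet A →
      (D y : Measure W) A = ∫⁻ g, (translate D g y : Measure W) A ∂μ)
    {f : W → ℝ} (hf : Measurable f) {C : ℝ} (hC : ∀ x, |f x| ≤ C) :
    ∫ x, f x ∂(D y : Measure W) = ∫ g, ∫ x, f x ∂(translate D g y : Measure W) ∂μ := by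
  have h : (D y : Measure W)
      = average μ (fun y g => translate D g y) (measurable_translate hD) y := by
    ext A hA
    rw [hy A hA, average_apply _ _ _ hA]
  rw [h, integral_average _ _ _ hf hC]

end Family

/-! ### Limits along the random walk -/

section Limit

variable {G X Y : Type*} [Group G] [MeasurableSpace G] [MeasurableInv G] [MeasurableMul₂ G]
  [MeasurableSpace Y] [MulAction G Y] [MeasurableSMul₂ G Y]
  [TopologicalSpace X] [CompactSpace X] [TopologicalSpace.MetrizableSpace X]
  [MeasurableSpace X] [BorelSpace X] [MulAction G X] [MeasurableSMul₂ G X]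

theorem measurable_integral_translate_walk {D : Y → ProbabilityMeasure X} (hD : Measurable D)
    (f : C(X, ℝ)) (y : Y) (n : ℕ) :
    Measurable fun ω : ℕ → G => ∫ x, f x ∂(translate D (walk ω n) y : Measure X) :=
  (measurable_integral_continuousMap f).comp
    ((measurable_translate hD).comp (measurable_const.prodMk (measurable_walk n)))

omit [TopologicalSpace.MetrizableSpace X] [BorelSpace X] in
theorem abs_integral_continuousMap_le (f : C(X, ℝ)) (m : ProbabilityMeasure X) :
    |∫ x, f x ∂(m : Measure X)| ≤ ‖f‖ := by
  refine (norm_integral_le_of_norm_le_const (G := ℝ) (C := ‖f‖) (μ := (m : Measure X))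
    (ae_of_all _ fun x => f.norm_coe_le_norm x)).trans ?_
  simp

/-- The integrals of a stationary family along the random walk form a martingale. -/
theorem integral_translate_walk_eq {μ : Measure G} [IsProbabilityMeasure μ]
    {D : Y → ProbabilityMeasure X} (hD : Measurable D) (f : C(X, ℝ)) (y : Y) (n : ℕ) (ω : ℕ → G)
    (hy : ∀ A : Set X, MeasurableSet A → (D ((walk ω n)⁻¹ • y) : Measure X) A
      = ∫⁻ g, (translate D g ((walk ω n)⁻¹ • y) : Measure X) A ∂μ) :
    ∫ x, f x ∂(translate D (walk ω n) y : Measure X)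
      = ∫ ω', ∫ x, f x ∂(translate D (walk (concat n ω ω') (n + 1)) y : Measure X)
          ∂(seqMeasure μ) := by
  set w := walk ω n with hw
  have hm : Measurable fun x => f (w • x) := f.continuous.measurable.comp (measurable_const_smul w)
  -- Stationarity is used at the point `w⁻¹ • y`, tested on `x ↦ f (w • x)`.
  have h1 : ∫ x, f x ∂(translate D w y : Measure X)
      = ∫ g, ∫ x, f x ∂(translate D (w * g) y : Measure X) ∂μ := by
    rw [translate, integral_smul_probabilityMeasure _ _ f.continuous.measurable,
      integral_eq_of_stationary hD hy hm (C := ‖f‖) fun x => f.norm_coe_le_norm _]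
    refine integral_congr_ae (ae_of_all _ fun g => ?_)
    simp only
    rw [translate_mul, integral_smul_probabilityMeasure _ _ f.continuous.measurable]
  have h2 : ∀ ω' : ℕ → G, walk (concat n ω ω') (n + 1) = w * ω' 0 := fun ω' => by
    rw [walk_concat_add, walk, walk, one_mul]
  simp only [h2]
  have h3 := integral_map (μ := seqMeasure μ) (φ := fun ω' => ω' 0)
    (f := fun g => ∫ x, f x ∂(translate D (w * g) y : Measure X))
    (measurePreserving_eval_seqMeasure μ 0).measurable.aemeasurable
    ((measurable_integral_continuousMap f).comp ((measurable_translate hD).comp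
      (measurable_const.prodMk (measurable_const_mul w)))).aestronglyMeasurable
  rw [h1, ← h3, (measurePreserving_eval_seqMeasure μ 0).map_eq]

omit [TopologicalSpace X] [CompactSpace X] [TopologicalSpace.MetrizableSpace X] [BorelSpace X] in
-- The martingale identity needs stationarity at every point `(walk ω n)⁻¹ • y` met along the path;
-- quasi-invariance of `η` keeps these points out of the exceptional null set.
theorem ae_ae_forall_stationary {μ : Measure G} [IsProbabilityMeasure μ] {η : Measure Y}
    [SFinite η] (hη : IsNonsingular G η) {D : Y → ProbabilityMeasure X}
    (hst : IsStationaryFamily μ η D) :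
    ∀ᵐ y ∂η, ∀ᵐ ω ∂(seqMeasure μ), ∀ n, ∀ A : Set X, MeasurableSet A →
      (D ((walk ω n)⁻¹ • y) : Measure X) A
        = ∫⁻ g, (translate D g ((walk ω n)⁻¹ • y) : Measure X) A ∂μ := by
  have h := ae_all_iff.2 fun n =>
    ae_ae_inv_smul hη (seqMeasure μ) (a := fun ω => walk ω n) (measurable_walk n) hst
  filter_upwards [h] with y hy
  exact ae_all_iff.2 hy

/-- Stationary families converge along almost every path of the random walk. -/
theorem ae_ae_exists_isLimitMeasure {μ : Measure G} [IsProbabilityMeasure μ] {η : Measure Y}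
    [SFinite η] (hη : IsNonsingular G η) {D : Y → ProbabilityMeasure X} (hD : Measurable D)
    (hst : IsStationaryFamily μ η D) :
    ∀ᵐ y ∂η, ∀ᵐ ω ∂(seqMeasure μ), ∃ m, IsLimitMeasure D y ω m := by
  obtain ⟨S, hS⟩ := exists_countable_exists_tendsto (W := X)
  filter_upwards [ae_ae_forall_stationary hη hst] with y hy
  have h : ∀ i, ∀ᵐ ω ∂(seqMeasure μ), ∃ c, Tendsto
      (fun n => ∫ x, S i x ∂(translate D (walk ω n) y : Measure X)) atTop (𝓝 c) := by
    intro i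
    refine exists_tendsto_of_integral_concat μ
      (fun n => measurable_integral_translate_walk hD (S i) y n) (C := ‖S i‖)
      (fun n ω => abs_integral_continuousMap_le _ _) (fun n ω => by rw [walk_trunc le_rfl])
      fun n => ?_
    filter_upwards [hy] with ω hω
    exact integral_translate_walk_eq hD (S i) y n ω (hω n)
  filter_upwards [ae_all_iff.2 h] with ω hω
  exact hS _ hω

open Classical in
/-- The limit `ν_{y,ω}`, with the value `m₀` where it does not exist. -/
noncomputable def limitMeasure (D : Y → ProbabilityMeasure X) (m₀ : ProbabilityMeasure X) (y : Y)
    (ω : ℕ → G) : ProbabilityMeasure X :=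
  if h : ∃ m, IsLimitMeasure D y ω m then h.choose else m₀

omit [MeasurableInv G] [MeasurableMul₂ G] [MeasurableSpace Y] [MeasurableSMul₂ G Y]
  [CompactSpace X] [TopologicalSpace.MetrizableSpace X] in
theorem isLimitMeasure_limitMeasure {D : Y → ProbabilityMeasure X} (m₀ : ProbabilityMeasure X)
    {y : Y} {ω : ℕ → G} (h : ∃ m, IsLimitMeasure D y ω m) :
    IsLimitMeasure D y ω (limitMeasure D m₀ y ω) := by
  rw [limitMeasure, dif_pos h]
  exact h.choose_spec

omit [MeasurableInv G] [MeasurableMul₂ G] [MeasurableSpace Y] [MeasurableSMul₂ G Y]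
  [CompactSpace X] in
theorem limitMeasure_eq {D : Y → ProbabilityMeasure X} (m₀ : ProbabilityMeasure X)
    {y : Y} {ω : ℕ → G} {m : ProbabilityMeasure X} (h : IsLimitMeasure D y ω m) :
    limitMeasure D m₀ y ω = m :=
  tendsto_nhds_unique (isLimitMeasure_limitMeasure m₀ ⟨m, h⟩) h

/-- The set of convergence is measurable because `ProbabilityMeasure X` is Polish. On it the limit
is a pointwise limit of measurable maps; off it the value is constant. -/
theorem measurable_limitMeasure {D : Y → ProbabilityMeasure X} (hD : Measurable D)
    (m₀ : ProbabilityMeasure X) :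
    Measurable (Function.uncurry (limitMeasure (G := G) D m₀)) := by
  classical
  have hu : ∀ n, Measurable fun p : Y × (ℕ → G) => translate D (walk p.2 n) p.1 := fun n =>
    (measurable_translate hD).comp
      (measurable_fst.prodMk ((measurable_walk n).comp measurable_snd))
  have hs : MeasurableSet {p : Y × (ℕ → G) | ∃ m, IsLimitMeasure D p.1 p.2 m} :=
    measurableSet_exists_tendsto hu
  refine measurable_of_tendsto_metrizable (f := fun n (p : Y × (ℕ → G)) =>
    if p ∈ {p : Y × (ℕ → G) | ∃ m, IsLimitMeasure D p.1 p.2 m}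
      then translate D (walk p.2 n) p.1 else m₀)
    (fun n => Measurable.ite hs (hu n) measurable_const) ?_
  rw [tendsto_pi_nhds]
  rintro ⟨y, ω⟩
  by_cases h : ∃ m, IsLimitMeasure D y ω m
  · exact (isLimitMeasure_limitMeasure m₀ h).congr fun n => (if_pos h).symm
  · simp [h, limitMeasure]

/-- A martingale has constant expectation, here its value at time `0`, the integral against `D y`;
dominated convergence passes this to the limit. -/
theorem average_limitMeasure {μ : Measure G} [IsProbabilityMeasure μ] {η : Measure Y}
    [SFinite η] (hη : IsNonsingular G η) {D : Y → ProbabilityMeasure X} (hD : Measurable D)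
    (hst : IsStationaryFamily μ η D) (m₀ : ProbabilityMeasure X) :
    ∀ᵐ y ∂η, average (seqMeasure μ) (limitMeasure D m₀) (measurable_limitMeasure hD m₀) y = D y := by
  filter_upwards [ae_ae_forall_stationary hη hst, ae_ae_exists_isLimitMeasure hη hD hst]
    with y hy hlim
  apply Subtype.ext
  refine ext_of_forall_integral_eq_of_IsFiniteMeasure
    (μ := (average (seqMeasure μ) (limitMeasure D m₀) (measurable_limitMeasure hD m₀) y : Measure X))
    (ν := (D y : Measure X)) fun f => ?_
  let F : C(X, ℝ) := f
  change ∫ x, F x ∂_ = ∫ x, F x ∂_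
  rw [integral_average _ _ _ F.continuous.measurable (C := ‖F‖) fun x => F.norm_coe_le_norm x]
  have hmart : ∀ n, ∫ ω, ∫ x, F x ∂(translate D (walk ω n) y : Measure X) ∂(seqMeasure μ)
      = ∫ x, F x ∂(D y : Measure X) := by
    intro n
    induction n with
    | zero =>
      simp only [walk, translate_one]
      simp
    | succ n ih =>
      rw [← ih]
      have hmp := measurePreserving_concat μ n
      have hmeas := measurable_integral_translate_walk (G := G) hD F y (n + 1)
      rw [← hmp.map_eq, integral_map hmp.measurable.aemeasurable hmeas.aestronglyMeasurable,
        integral_prod, hmp.map_eq]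
      · refine integral_congr_ae ?_
        filter_upwards [hy] with ω hω
        exact (integral_translate_walk_eq hD F y n ω (hω n)).symm
      · exact Integrable.of_bound (hmeas.comp (measurable_concat n)).aestronglyMeasurable ‖F‖
          (ae_of_all _ fun p => abs_integral_continuousMap_le F _)
  refine tendsto_nhds_unique (f := fun n : ℕ =>
    ∫ ω, ∫ x, F x ∂(translate D (walk ω n) y : Measure X) ∂(seqMeasure μ)) (l := atTop) ?_ ?_
  · refine tendsto_integral_of_dominated_convergence (fun _ => ‖F‖)
      (fun n => (measurable_integral_translate_walk hD F y n).aestronglyMeasurable)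
      (integrable_const _) (fun n => ae_of_all _ fun ω => abs_integral_continuousMap_le F _) ?_
    filter_upwards [hlim] with ω hω
    exact ProbabilityMeasure.tendsto_iff_forall_integral_tendsto.1
      (isLimitMeasure_limitMeasure m₀ hω) f
  · simp only [hmart]
    exact tendsto_const_nhds

/-- The family `K y ω` is equivariant along the random walk. -/
def IsEquivariantFamily {W : Type*} [MeasurableSpace W] [MulAction G W] [MeasurableConstSMul G W]
    (μ : Measure G) [IsProbabilityMeasure μ] (η : Measure Y)
    (K : Y → (ℕ → G) → ProbabilityMeasure W) : Prop :=
  ∀ᵐ y ∂η, ∀ n, ∀ᵐ p ∂((seqMeasure μ).prod (seqMeasure μ)),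
    K y (concat n p.1 p.2) = walk p.1 n • K ((walk p.1 n)⁻¹ • y) p.2

omit [MeasurableInv G] [MeasurableMul₂ G] [MeasurableSpace Y] [MeasurableSMul₂ G Y]
  [CompactSpace X] [TopologicalSpace.MetrizableSpace X] in
-- Dropping the first `n` terms does not change the limit, and `(walk ω n)⁻¹` acts continuously on
-- measures.
theorem IsLimitMeasure.of_concat [ContinuousConstSMul G X] {D : Y → ProbabilityMeasure X} {y : Y}
    {n : ℕ} {ω ω' : ℕ → G} {m : ProbabilityMeasure X} (h : IsLimitMeasure D y (concat n ω ω') m) :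
    IsLimitMeasure D ((walk ω n)⁻¹ • y) ω' ((walk ω n)⁻¹ • m) := by
  have h1 := ((continuous_smul_probabilityMeasure (walk ω n)⁻¹).tendsto m).comp
    ((tendsto_add_atTop_iff_nat n).2 h)
  refine h1.congr fun k => ?_
  simp only [Function.comp]
  rw [add_comm k n, walk_concat_add, translate_mul, inv_smul_smul]

/-- Existence is needed for the spliced path only: `IsLimitMeasure.of_concat` then produces the
limit of the restarted path, and uniqueness identifies it. -/
theorem isEquivariantFamily_limitMeasure [ContinuousConstSMul G X] {μ : Measure G}
    [IsProbabilityMeasure μ] {η : Measure Y}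
    [SFinite η] (hη : IsNonsingular G η) {D : Y → ProbabilityMeasure X} (hD : Measurable D)
    (hst : IsStationaryFamily μ η D) (m₀ : ProbabilityMeasure X) :
    IsEquivariantFamily μ η (limitMeasure (G := G) D m₀) := by
  filter_upwards [ae_ae_exists_isLimitMeasure hη hD hst] with y hy n
  filter_upwards [(measurePreserving_concat μ n).quasiMeasurePreserving.ae hy] with p hp
  rw [limitMeasure_eq m₀ (isLimitMeasure_limitMeasure m₀ hp).of_concat, smul_inv_smul]

end Limit

/-! ### Averages of equivariant families -/

section Equivariant

variable {G W Y : Type*} [Group G] [MeasurableSpace G] [MeasurableInv G] [MeasurableMul₂ G]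
  [MeasurableSpace Y] [MulAction G Y] [MeasurableSMul₂ G Y]
  [MeasurableSpace W] [MulAction G W] [MeasurableSMul₂ G W]
  {μ : Measure G} [IsProbabilityMeasure μ] {η : Measure Y}
  {K : Y → (ℕ → G) → ProbabilityMeasure W} (hK : Measurable (Function.uncurry K))

omit [MeasurableMul₂ G] in
include hK in
-- Condition on the first increment and use equivariance with `n = 1`.
theorem IsEquivariantFamily.isStationaryFamily (hE : IsEquivariantFamily μ η K) :
    IsStationaryFamily μ η (average (seqMeasure μ) K hK) := by
  filter_upwards [hE] with y hy A hA
  have hmA : Measurable fun ω => (K y ω : Measure W) A :=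
    (measurable_probabilityMeasure_iff.1 hK A hA).comp measurable_prodMk_left
  have hmp := measurePreserving_concat μ 1
  have hw : ∀ ω : ℕ → G, walk ω 1 = ω 0 := fun ω => by rw [walk, walk, one_mul]
  have hmt : Measurable fun g : G =>
      (translate (average (seqMeasure μ) K hK) g y : Measure W) A :=
    measurable_translate_apply (measurable_average (seqMeasure μ) hK) y hA
  have h1 : ∫⁻ ω, (K y ω : Measure W) A ∂(seqMeasure μ)
      = ∫⁻ ω, ∫⁻ ω', (K y (concat 1 ω ω') : Measure W) A ∂(seqMeasure μ) ∂(seqMeasure μ) := by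
    rw [← hmp.lintegral_comp hmA]
    exact lintegral_prod (fun p => (K y (concat 1 p.1 p.2) : Measure W) A)
      (hmA.comp hmp.measurable).aemeasurable
  have h2 := (measurePreserving_eval_seqMeasure μ 0).lintegral_comp hmt
  rw [average_apply _ _ _ hA, h1, ← h2]
  refine lintegral_congr_ae ?_
  filter_upwards [Measure.ae_ae_of_ae_prod (hy 1)] with ω hω
  have h3 : (translate (average (seqMeasure μ) K hK) (ω 0) y : Measure W) A
      = ∫⁻ ω', (K ((ω 0)⁻¹ • y) ω' : Measure W) ((fun x => ω 0 • x) ⁻¹' A) ∂(seqMeasure μ) := by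
    rw [translate, smul_apply _ _ hA, average_apply _ _ _ (measurable_const_smul (ω 0) hA)]
  rw [h3]
  refine lintegral_congr_ae ?_
  filter_upwards [hω] with ω' hω'
  rw [hω', smul_apply _ _ hA, hw]

omit [MeasurableInv G] [MeasurableMul₂ G] [MeasurableSMul₂ G Y] in
/-- The averages of an equivariant family converge to its values along the random walk. -/
theorem IsEquivariantFamily.isLimitMeasure [TopologicalSpace W] [CompactSpace W]
    [TopologicalSpace.MetrizableSpace W] [BorelSpace W] (hE : IsEquivariantFamily μ η K) :
    ∀ᵐ y ∂η, ∀ᵐ ω ∂(seqMeasure μ),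
      IsLimitMeasure (average (seqMeasure μ) K hK) y ω (K y ω) := by
  obtain ⟨S, hS⟩ := exists_countable_tendsto (W := W)
  filter_upwards [hE] with y hy
  -- By equivariance, the integral of `S i` against the `n`-th translate of the average is the
  -- expectation of `∫ S i ∂(K y ω)` after resampling all but the first `n` increments, so Lévy's
  -- theorem gives the limit.
  have h1 := ae_all_iff.2 fun i => tendsto_integral_concat μ
    (H := fun ω => ∫ x, S i x ∂(K y ω : Measure W)) (C := ‖S i‖)
    ((measurable_integral_continuousMap (S i)).comp (hK.comp measurable_prodMk_left))
    (fun ω => abs_integral_continuousMap_le (S i) _)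
  have h2 := ae_all_iff.2 fun n => Measure.ae_ae_of_ae_prod (hy n)
  filter_upwards [h1, h2] with ω h1 h2
  refine hS _ _ fun i => (h1 i).congr fun n => ?_
  set w := walk ω n with hw
  rw [translate, integral_smul_probabilityMeasure _ _ (S i).continuous.measurable,
    integral_average _ _ _ (f := fun x => S i (w • x))
      ((S i).continuous.measurable.comp (measurable_const_smul w))
      (C := ‖S i‖) fun x => (S i).norm_coe_le_norm _]
  refine integral_congr_ae ?_
  filter_upwards [h2 n] with ω' hω'
  rw [hω', integral_smul_probabilityMeasure _ _ (S i).continuous.measurable]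

end Equivariant

/-! ### Quasi-invariance of averages of stationary families -/

section Haar

variable {G : Type*} [Group G] [TopologicalSpace G] [IsTopologicalGroup G] [LocallyCompactSpace G]
  [SecondCountableTopology G] [MeasurableSpace G] [BorelSpace G]

/-- A bounded function that is harmonic for an absolutely continuous measure is continuous. -/
theorem continuous_of_eq_integral_mul {κ : Measure G} [IsProbabilityMeasure κ]
    (hκ : κ ≪ Measure.haar) {Φ : G → ℝ} (hΦ : Measurable Φ) (hb : ∀ g, |Φ g| ≤ 1)
    (hharm : ∀ h, Φ h = ∫ g, Φ (h * g) ∂κ) : Continuous Φ := by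
  set m : Measure G := Measure.haar
  let f : G → ℝ := fun g => (κ.rnDeriv m g).toReal
  have hf : Integrable f m := Measure.integrable_toReal_rnDeriv
  let F : Lp ℝ 1 m := (memLp_one_iff_integrable.2 hf).toLp f
  let T : Lp ℝ 1 m → ℝ := fun a => ∫ g, a g * Φ g ∂m
  have hint : ∀ a : Lp ℝ 1 m, Integrable (fun g => a g * Φ g) m := fun a =>
    (L1.integrable_coeFn a).mul_bdd (c := 1) hΦ.aestronglyMeasurable (ae_of_all _ hb)
  have hT : Continuous T := by
    refine (LipschitzWith.of_dist_le_mul (K := 1) fun a b => ?_).continuous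
    have hab : Integrable (fun g => dist (a g) (b g)) m := by
      simp only [dist_eq_norm]
      exact ((L1.integrable_coeFn a).sub (L1.integrable_coeFn b)).norm
    rw [NNReal.coe_one, one_mul, L1.dist_eq_integral_dist, dist_eq_norm]
    change ‖(∫ g, a g * Φ g ∂m) - ∫ g, b g * Φ g ∂m‖ ≤ _
    rw [← integral_sub (hint a) (hint b)]
    refine norm_integral_le_of_norm_le hab (ae_of_all _ fun g => ?_)
    rw [← sub_mul, norm_mul, dist_eq_norm]
    exact mul_le_of_le_one_right (norm_nonneg _) (hb g)
  -- With `f` the density of `κ`, harmonicity and left invariance of `m` make `Φ h` the pairing of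
  -- `Φ` with the left translate `f (h⁻¹ * g)`. Translation is continuous in `L¹` and `T` is
  -- Lipschitz there, whence continuity in `h`.
  have hkey : ∀ h, Φ h = T (DomMulAct.mk h⁻¹ • F) := by
    intro h
    have hF : ∀ᵐ g ∂m, (DomMulAct.mk h⁻¹ • F : Lp ℝ 1 m) g = f (h⁻¹ * g) := by
      have h1 := DomMulAct.smul_Lp_ae_eq (DomMulAct.mk h⁻¹) F
      have h2 := (measurePreserving_mul_left m h⁻¹).quasiMeasurePreserving.ae
        (memLp_one_iff_integrable.2 hf).coeFn_toLp
      filter_upwards [h1, h2] with g h1 h2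
      rw [h1]
      exact h2
    calc Φ h = ∫ g, Φ (h * g) ∂κ := hharm h
      _ = ∫ g, f g • Φ (h * g) ∂m := (integral_rnDeriv_smul hκ).symm
      _ = ∫ g, (fun g => f (h⁻¹ * g) * Φ g) (h * g) ∂m := by simp
      _ = ∫ g, f (h⁻¹ * g) * Φ g ∂m :=
        integral_mul_left_eq_self (μ := m) (fun g => f (h⁻¹ * g) * Φ g) h
      _ = T (DomMulAct.mk h⁻¹ • F) := by
        refine integral_congr_ae ?_
        filter_upwards [hF] with g hg
        rw [hg]
  rw [show Φ = fun h => T (DomMulAct.mk h⁻¹ • F) from funext hkey]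
  have : Fact ((1 : ENNReal) ≠ ⊤) := ⟨ENNReal.one_ne_top⟩
  exact hT.comp ((DomMulAct.continuous_mk.comp continuous_inv).smul continuous_const)

end Haar

section ConvPow

variable {G : Type*} [Group G] [MeasurableSpace G] [MeasurableMul₂ G]

theorem isProbabilityMeasure_convPow (μ : Measure G) [IsProbabilityMeasure μ] (k : ℕ) :
    IsProbabilityMeasure (convPow μ k) := by
  induction k with
  | zero => exact inferInstanceAs (IsProbabilityMeasure (Measure.dirac 1))
  | succ k ih => exact inferInstanceAs (IsProbabilityMeasure (Measure.mconv (convPow μ k) μ))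

variable [MeasurableInv G] {W Y : Type*} [MeasurableSpace W]
  [MulAction G W] [MeasurableSMul₂ G W] [MeasurableSpace Y] [MulAction G Y] [MeasurableSMul₂ G Y]

/-- Only some convolution power of `μ` is assumed absolutely continuous, so harmonicity for that
power is needed to obtain continuity. -/
theorem IsStationaryFamily.convPow {μ : Measure G} [IsProbabilityMeasure μ] {η : Measure Y}
    [SFinite η] (hη : IsNonsingular G η) {R : Y → ProbabilityMeasure W} (hR : Measurable R)
    (hst : IsStationaryFamily μ η R) (k : ℕ) : IsStationaryFamily (convPow μ k) η R := by
  induction k with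
  | zero =>
    refine ae_of_all _ fun y A hA => ?_
    rw [RelStationary.convPow, lintegral_dirac' _ (measurable_translate_apply hR y hA),
      translate_one]
  | succ k ih =>
    have := isProbabilityMeasure_convPow μ k
    filter_upwards [ih, ae_ae_inv_smul hη (RelStationary.convPow μ k) measurable_id hst]
      with y hy hy' A hA
    rw [RelStationary.convPow, Measure.lintegral_mconv (measurable_translate_apply hR y hA),
      hy A hA]
    refine lintegral_congr_ae ?_
    filter_upwards [hy'] with g hg
    have h1 := hg _ (measurable_const_smul g hA)
    rw [translate, smul_apply _ _ hA]
    refine h1.trans (lintegral_congr fun h => ?_)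
    rw [translate_mul, smul_apply _ _ hA]
    rfl

end ConvPow

section Nonsingular

variable {G W Y : Type*} [Group G] [TopologicalSpace G] [IsTopologicalGroup G]
  [LocallyCompactSpace G] [SecondCountableTopology G] [MeasurableSpace G] [BorelSpace G]
  [MeasurableSpace W] [MulAction G W] [MeasurableSMul₂ G W]
  [MeasurableSpace Y] [MulAction G Y] [MeasurableSMul₂ G Y]

/-- The average of a stationary family over a quasi-invariant measure is quasi-invariant. -/
theorem IsStationaryFamily.isNonsingular {μ : Measure G} [IsProbabilityMeasure μ]
    (hμ : IsAdmissible μ) {η : Measure Y} [IsProbabilityMeasure η] (hη : IsNonsingular G η)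
    {R : Y → ProbabilityMeasure W} (hR : Measurable R) (hst : IsStationaryFamily μ η R)
    {ξ : Measure W} (hξ : ∀ A, MeasurableSet A → ξ A = ∫⁻ y, (R y : Measure W) A ∂η) :
    IsNonsingular G ξ := by
  suffices h : ∀ g : G, ∀ A, MeasurableSet A → ξ A = 0 → ξ ((fun x => g • x) ⁻¹' A) = 0 from
    fun g => ⟨measurable_const_smul g, Measure.AbsolutelyContinuous.mk fun A hA hA0 => by
      rw [Measure.map_apply (measurable_const_smul g) hA]
      exact h g A hA hA0⟩
  obtain ⟨k, -, hk⟩ := hμ.exists_convPow_ac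
  have hprob := isProbabilityMeasure_convPow μ k
  have hsupp : ∀ s ∈ Measure.support μ, ∀ A, MeasurableSet A → ξ A = 0 →
      ξ ((fun x => s • x) ⁻¹' A) = 0 := by
    intro s hs A hA hA0
    have hjoint : Measurable fun p : Y × G => (translate R p.2 p.1 : Measure W) A :=
      measurable_probabilityMeasure_iff.1 (measurable_translate hR) A hA
    -- `Ψ 1 = ξ A = 0`, and `Ψ` is harmonic for `μ` and its powers. Harmonicity for `μ` makes `Ψ`
    -- vanish `μ`-almost everywhere; harmonicity for the `k`-th power makes it continuous, so it
    -- vanishes at every point of the support. By quasi-invariance of `η`, `Ψ s = 0` says that the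
    -- preimage of `A` under `s` is `ξ`-null.
    let Ψ : G → ENNReal := fun h => ∫⁻ y, (translate R h y : Measure W) A ∂η
    have hΨm : Measurable Ψ := hjoint.lintegral_prod_left'
    have hΨ1 : ∀ h, Ψ h ≤ 1 := fun h => by
      refine (lintegral_mono (g := fun _ => 1) fun y => prob_le_one).trans ?_
      simp
    have hΨt : ∀ h, Ψ h ≠ ⊤ := fun h => ne_top_of_le_ne_top ENNReal.one_ne_top (hΨ1 h)
    have hswap : ∀ (κ : Measure G) [IsProbabilityMeasure κ] (h : G), IsStationaryFamily κ η R →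
        Ψ h = ∫⁻ g, Ψ (h * g) ∂κ := by
      intro κ _ h hκ
      have h1 : ∀ᵐ y ∂η, (translate R h y : Measure W) A
          = ∫⁻ g, (translate R (h * g) y : Measure W) A ∂κ := by
        filter_upwards [(hη h⁻¹).ae hκ] with y hy
        rw [translate, smul_apply _ _ hA, hy _ (measurable_const_smul h hA)]
        refine lintegral_congr fun g => ?_
        rw [translate_mul, smul_apply _ _ hA]
      calc Ψ h = ∫⁻ y, ∫⁻ g, (translate R (h * g) y : Measure W) A ∂κ ∂η := lintegral_congr_ae h1
        _ = ∫⁻ g, Ψ (h * g) ∂κ := by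
          refine lintegral_lintegral_swap (Measurable.aemeasurable ?_)
          exact hjoint.comp (measurable_fst.prodMk (measurable_const.mul measurable_snd))
    have hcont : Continuous fun h => (Ψ h).toReal := by
      refine continuous_of_eq_integral_mul hk hΨm.ennreal_toReal (fun h => ?_) fun h => ?_
      · rw [abs_of_nonneg ENNReal.toReal_nonneg]
        exact ENNReal.toReal_le_of_le_ofReal zero_le_one (by simpa using hΨ1 h)
      · rw [integral_toReal (f := fun g => Ψ (h * g)) (hΨm.comp (measurable_const_mul h)).aemeasurable
          (ae_of_all _ fun g => (hΨt _).lt_top), ← hswap _ h (hst.convPow hη hR k)]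
    have hae : ∀ᵐ g ∂μ, Ψ g = 0 := by
      have h1 : ∫⁻ g, Ψ g ∂μ = 0 := by
        have h2 := hswap μ 1 hst
        simp only [one_mul] at h2
        rw [← h2]
        simp only [Ψ, translate_one]
        rw [← hξ A hA, hA0]
      exact (lintegral_eq_zero_iff hΨm).1 h1
    have hs0 : Ψ s = 0 := by
      by_contra hne
      have hpos : 0 < (Ψ s).toReal := ENNReal.toReal_pos hne (hΨt s)
      have hU := hcont.continuousAt.eventually (lt_mem_nhds hpos)
      have h1 := (Measure.mem_support_iff_forall s).1 hs _ hU
      refine h1.ne' (measure_mono_null (fun g hg => ?_) (ae_iff.1 hae))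
      intro h0
      simp [h0] at hg
    have h1 : ∀ᵐ y ∂η, (translate R s y : Measure W) A = 0 :=
      (lintegral_eq_zero_iff (hjoint.comp measurable_prodMk_right)).1 hs0
    rw [hξ _ (measurable_const_smul s hA)]
    refine (lintegral_congr_ae ?_).trans lintegral_zero
    filter_upwards [(hη s).ae h1] with y hy
    rwa [translate, smul_apply _ _ hA, inv_smul_smul] at hy
  intro g
  have hg : g ∈ Subsemigroup.closure (Measure.support μ) := by rw [hμ.closure_support]; trivial
  -- Stability of null sets passes from generators to products, and the semigroup generated is all
  -- of `G`, so inverses need no separate argument.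
  induction hg using Subsemigroup.closure_induction with
  | mem s hs => exact hsupp s hs
  | mul a b _ _ iha ihb =>
    intro A hA hA0
    have h := ihb _ (measurable_const_smul a hA) (iha A hA hA0)
    convert h using 2
    ext x
    simp [mul_smul]

end Nonsingular

/-! ### Disintegrations -/

section Disintegration

variable {X Y : Type*} [MeasurableSpace X] [MeasurableSpace Y]

theorem IsDisintegration.measurable_family {π : X → Y} {ν : Measure X} {η : Measure Y}
    {D : Y → ProbabilityMeasure X} (hD : IsDisintegration π ν η D) : Measurable D :=
  measurable_probabilityMeasure_iff.2 hD.measurable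

theorem IsDisintegration.ae_null {π : X → Y} {ν : Measure X} {η : Measure Y}
    {D : Y → ProbabilityMeasure X} (hD : IsDisintegration π ν η D) {A : Set X}
    (hA : MeasurableSet A) (h0 : ν A = 0) : ∀ᵐ y ∂η, (D y : Measure X) A = 0 :=
  (lintegral_eq_zero_iff (hD.measurable A hA)).1 ((hD.integral A hA).symm.trans h0)

theorem IsDisintegration.map_eq {π : X → Y} (hπ : Measurable π) {ν : Measure X} {η : Measure Y}
    {D : Y → ProbabilityMeasure X} (hD : IsDisintegration π ν η D) : ν.map π = η := by
  ext B hB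
  rw [Measure.map_apply hπ hB, hD.integral _ (hπ hB), ← lintegral_indicator_one hB]
  refine lintegral_congr_ae ?_
  filter_upwards [hD.fibre] with y hy
  by_cases h : y ∈ B
  · rw [Set.indicator_of_mem h, Pi.one_apply, ← prob_compl_eq_zero_iff (hπ hB)]
    exact measure_mono_null (Set.compl_subset_compl.2 fun x hx => by
      rw [Set.mem_preimage, Set.mem_singleton_iff] at hx
      rwa [Set.mem_preimage, hx]) hy
  · rw [Set.indicator_of_notMem h]
    refine measure_mono_null (fun x hx (hxy : x ∈ π ⁻¹' {y}) => h ?_) hy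
    rw [Set.mem_preimage, Set.mem_singleton_iff] at hxy
    rwa [Set.mem_preimage, hxy] at hx

/-- The average over `η` of a family of averages is disintegrated by these averages. -/
theorem isDisintegration_bind_average {Ω : Type*} [MeasurableSpace Ω] {P : Measure Ω}
    [IsProbabilityMeasure P] {K : Y → Ω → ProbabilityMeasure X}
    (hK : Measurable (Function.uncurry K)) {ψ : X → Y} {η : Measure Y} (hψ : Measurable ψ)
    [MeasurableSingletonClass Y] (h : ∀ᵐ y ∂η, ∀ᵐ ω ∂P, (K y ω : Measure X) (ψ ⁻¹' {y})ᶜ = 0) :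
    IsDisintegration ψ (η.bind fun y => (average P K hK y : Measure X)) η (average P K hK) where
  measurable := measurable_probabilityMeasure_iff.1 (measurable_average P hK)
  fibre := by
    filter_upwards [h] with y hy
    rw [average_apply _ _ _ (hψ (measurableSet_singleton y)).compl, lintegral_congr_ae hy]
    exact lintegral_zero
  integral A hA := Measure.bind_apply hA
    (measurable_coe_average P hK).aemeasurable

theorem bind_average_apply {Ω : Type*} [MeasurableSpace Ω] {P : Measure Ω}
    [IsProbabilityMeasure P] {K : Y → Ω → ProbabilityMeasure X}
    (hK : Measurable (Function.uncurry K)) {η : Measure Y} {A : Set X} (hA : MeasurableSet A) :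
    (η.bind fun y => (average P K hK y : Measure X)) A
      = ∫⁻ y, ∫⁻ ω, (K y ω : Measure X) A ∂P ∂η := by
  rw [Measure.bind_apply hA
    (measurable_coe_average P hK).aemeasurable]
  simp only [average_apply P hK _ hA]

theorem lintegral_bind_average {Ω : Type*} [MeasurableSpace Ω] {P : Measure Ω}
    [IsProbabilityMeasure P] {K : Y → Ω → ProbabilityMeasure X}
    (hK : Measurable (Function.uncurry K)) {η : Measure Y} {f : X → ENNReal} (hf : Measurable f) :
    ∫⁻ x, f x ∂(η.bind fun y => (average P K hK y : Measure X))
      = ∫⁻ y, ∫⁻ ω, ∫⁻ x, f x ∂(K y ω : Measure X) ∂P ∂η := by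
  rw [Measure.lintegral_bind
    (measurable_coe_average P hK).aemeasurable hf.aemeasurable]
  simp only [lintegral_average P hK _ hf]

theorem bind_average_eq_zero {Ω : Type*} [MeasurableSpace Ω] {P : Measure Ω}
    [IsProbabilityMeasure P] {K : Y → Ω → ProbabilityMeasure X}
    (hK : Measurable (Function.uncurry K)) {η : Measure Y} {A : Set X} (hA : MeasurableSet A)
    (h : ∀ᵐ y ∂η, ∀ᵐ ω ∂P, (K y ω : Measure X) A = 0) :
    (η.bind fun y => (average P K hK y : Measure X)) A = 0 := by
  rw [bind_average_apply hK hA]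
  refine (lintegral_congr_ae ?_).trans lintegral_zero
  filter_upwards [h] with y hy
  exact (lintegral_congr_ae hy).trans lintegral_zero

theorem isProbabilityMeasure_bind_average {Ω : Type*} [MeasurableSpace Ω] {P : Measure Ω}
    [IsProbabilityMeasure P] {K : Y → Ω → ProbabilityMeasure X}
    (hK : Measurable (Function.uncurry K)) {η : Measure Y} [IsProbabilityMeasure η] :
    IsProbabilityMeasure (η.bind fun y => (average P K hK y : Measure X)) :=
  isProbabilityMeasure_bind
    (measurable_coe_average P hK).aemeasurable
    (ae_of_all _ fun _ => inferInstance)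

/-- The second coordinate is the random measure `L` itself; given `L = m`, the first coordinate has
law `m`. -/
theorem isDisintegration_snd_prod_diracProba {Ω : Type*} [MeasurableSpace Ω] {P : Measure Ω}
    [IsProbabilityMeasure P] [MeasurableSingletonClass (ProbabilityMeasure X)]
    {L : Y → Ω → ProbabilityMeasure X}
    (hK₁ : Measurable (Function.uncurry fun y ω => diracProba (L y ω)))
    (hK₂ : Measurable (Function.uncurry fun y ω => (L y ω).prod (diracProba (L y ω))))
    {η : Measure Y} :
    IsDisintegration Prod.snd
      (η.bind fun y => (average P (fun y ω => (L y ω).prod (diracProba (L y ω))) hK₂ y :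
        Measure (X × ProbabilityMeasure X)))
      (η.bind fun y => (average P (fun y ω => diracProba (L y ω)) hK₁ y :
        Measure (ProbabilityMeasure X)))
      (fun m => m.prod (diracProba m)) := by
  have hm : Measurable fun m : ProbabilityMeasure X => m.prod (diracProba m) :=
    measurable_probabilityMeasure_prod measurable_id measurable_diracProba
  refine ⟨measurable_probabilityMeasure_iff.1 hm, ae_of_all _ fun m => ?_, fun A hA => ?_⟩
  · have h : (Prod.snd ⁻¹' {m} : Set (X × ProbabilityMeasure X))ᶜ = Set.univ ×ˢ {m}ᶜ := by
      ext p
      simp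
    change ((m : Measure X).prod (Measure.dirac m)) _ = 0
    rw [h, Measure.prod_prod, Measure.dirac_apply' _ (measurableSet_singleton m).compl]
    simp
  · have hmA := measurable_probabilityMeasure_iff.1 hm A hA
    rw [bind_average_apply hK₂ hA, lintegral_bind_average hK₁ hmA]
    refine lintegral_congr fun y => lintegral_congr fun ω => ?_
    exact (lintegral_dirac' (L y ω) hmA).symm

end Disintegration

/-! ### The point over which a measure lives -/

section FibreMap

variable {X Y : Type*} [MeasurableSpace X] [MeasurableSpace Y] [StandardBorelSpace Y]

/-- There is a measurable map sending every measure on a fibre of `π` to the base point. -/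
theorem exists_measurable_fibreMap [Nonempty Y] {π : X → Y} (hπ : Measurable π) :
    ∃ φ : ProbabilityMeasure X → Y, Measurable φ ∧
      ∀ (m : ProbabilityMeasure X) (y : Y), (m : Measure X) (π ⁻¹' {y})ᶜ = 0 → φ m = y := by
  have he := measurableEmbedding_embeddingReal Y
  obtain ⟨r, hr, hre⟩ := he.exists_measurable_extend measurable_id fun _ => inferInstance
  -- Embed `Y` in `ℝ` and average: on a measure carried by the fibre over `y` the integrand is
  -- almost surely constant, and the left inverse `r` recovers `y`. The value at other measures is
  -- arbitrary.
  refine ⟨fun m => r (∫ x, embeddingReal Y (π x) ∂(m : Measure X)), hr.comp ?_, fun m y hm => ?_⟩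
  · exact ((he.measurable.comp hπ).stronglyMeasurable.integral_kernel
      (κ := evalKernel X)).measurable
  · have h : ∫ x, embeddingReal Y (π x) ∂(m : Measure X) = embeddingReal Y y := by
      have hae : ∀ᵐ x ∂(m : Measure X), π x = y := hm
      rw [integral_congr_ae (g := fun _ => embeddingReal Y y)]
      · simp
      · filter_upwards [hae] with x hx
        rw [hx]
    simp only [h]
    exact congrFun hre y

theorem measurable_measure_fibre_compl {π : X → Y} (hπ : Measurable π)
    {φ : ProbabilityMeasure X → Y} (hφ : Measurable φ) :
    Measurable fun m : ProbabilityMeasure X => (m : Measure X) (π ⁻¹' {φ m})ᶜ := by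
  have hs : MeasurableSet {p : ProbabilityMeasure X × X | π p.2 = φ p.1}ᶜ :=
    (measurableSet_eq_fun (hπ.comp measurable_snd) (hφ.comp measurable_fst)).compl
  exact measurable_section_probabilityMeasure measurable_id hs

/-- The base point map is a factor map if it is defined almost everywhere. -/
theorem isFactorMap_fibreMap {G : Type*} [Group G] [MulAction G X] [MeasurableConstSMul G X]
    [MulAction G Y] {π : X → Y} {ν : Measure X} {η : Measure Y} (hπ : IsFactorMap G π ν η)
    {φ : ProbabilityMeasure X → Y} (hφm : Measurable φ)
    (hφ : ∀ (m : ProbabilityMeasure X) (y : Y), (m : Measure X) (π ⁻¹' {y})ᶜ = 0 → φ m = y)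
    {ξ : Measure (ProbabilityMeasure X)} (hξ : IsNonsingular G ξ) (hmap : ξ.map φ = η)
    (hfib : ∀ᵐ m : ProbabilityMeasure X ∂ξ, (m : Measure X) (π ⁻¹' {φ m})ᶜ = 0)
    (hnull : ∀ A, MeasurableSet A → ν A = 0 → ∀ᵐ m : ProbabilityMeasure X ∂ξ, (m : Measure X) A = 0) :
    IsFactorMap G φ ξ η where
  nonsingular_source := hξ
  nonsingular_target := hπ.nonsingular_target
  measurable := hφm
  map_eq := hmap
  exists_conull := by
    obtain ⟨X₀, Y₀, hX₀, hY₀, hνX₀, hηY₀, hinv, heq, himg⟩ := hπ.exists_conull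
    -- Carried by one fibre alone would not suffice: `π` is equivariant only on `X₀`, so the
    -- measures must also be carried by `X₀`.
    let S : Set (ProbabilityMeasure X) :=
      {m | (m : Measure X) X₀ᶜ = 0} ∩ {m | (m : Measure X) (π ⁻¹' {φ m})ᶜ = 0}
    have hsmul : ∀ (g : G) (m : ProbabilityMeasure X), m ∈ S →
        ((g • m : ProbabilityMeasure X) : Measure X) X₀ᶜ = 0 ∧
        ((g • m : ProbabilityMeasure X) : Measure X) (π ⁻¹' {g • φ m})ᶜ = 0 := by
      rintro g m ⟨h1, h2⟩
      constructor
      · rw [smul_apply _ _ hX₀.compl]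
        exact measure_mono_null (fun x hx hx0 => hx (hinv g x hx0)) h1
      · rw [smul_apply _ _ (hπ.measurable (measurableSet_singleton _)).compl]
        refine measure_mono_null (fun x hx => ?_) (measure_union_null h1 h2)
        by_cases hx0 : x ∈ X₀
        · refine Or.inr fun hxm => hx ?_
          rw [Set.mem_preimage, Set.mem_singleton_iff] at hxm
          rw [Set.mem_preimage, Set.mem_singleton_iff, heq g x hx0, hxm]
        · exact Or.inl hx0
    have hequiv : ∀ (g : G) (m : ProbabilityMeasure X), m ∈ S → φ (g • m) = g • φ m :=
      fun g m hm => hφ _ _ (hsmul g m hm).2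
    refine ⟨S, Y₀, ?_, hY₀, ?_, hηY₀, fun g m hm => ⟨(hsmul g m hm).1, ?_⟩, hequiv, ?_⟩
    · exact (measurable_probabilityMeasure_iff.1 measurable_id _ hX₀.compl
        (measurableSet_singleton 0)).inter
        (measurable_measure_fibre_compl hπ.measurable hφm (measurableSet_singleton 0))
    · exact (hnull _ hX₀.compl hνX₀).and hfib
    · rw [Set.mem_ofPred_eq, hequiv g m hm]
      exact (hsmul g m hm).2
    · ext y
      constructor
      · rintro ⟨m, ⟨h1, h2⟩, rfl⟩
        -- Such an `m` gives full mass to `X₀ ∩ π⁻¹ {φ m}`, which is therefore nonempty; hence `φ m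
        -- ∈ π '' X₀ = Y₀`. In the other direction, point masses at points of `X₀` reach all of
        -- `Y₀`.
        have hne : ((m : Measure X)) (X₀ᶜ ∪ (π ⁻¹' {φ m})ᶜ)ᶜ ≠ 0 := fun h0 => by
          have h := measure_union_null h0 (measure_union_null h1 h2)
          rw [Set.compl_union_self] at h
          simp at h
        obtain ⟨x, hx⟩ := nonempty_of_measure_ne_zero hne
        rw [Set.compl_union, compl_compl, compl_compl] at hx
        rw [← himg]
        exact ⟨x, hx.1, hx.2⟩
      · intro hy
        rw [← himg] at hy
        obtain ⟨x, hx, rfl⟩ := hy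
        have hd : ((diracProba x : ProbabilityMeasure X) : Measure X) (π ⁻¹' {π x})ᶜ = 0 := by
          change Measure.dirac x _ = 0
          rw [Measure.dirac_apply' _ (hπ.measurable (measurableSet_singleton _)).compl]
          simp
        have hφx := hφ _ _ hd
        refine ⟨diracProba x, ⟨?_, ?_⟩, hφx⟩
        · change Measure.dirac x _ = 0
          rw [Measure.dirac_apply' _ hX₀.compl]
          simp [hx]
        · rw [Set.mem_ofPred_eq, hφx]
          exact hd

end FibreMap

theorem measurableSMul₂_of_continuousSMul {G X : Type*} [TopologicalSpace G]
    [SecondCountableTopology G] [MeasurableSpace G] [BorelSpace G]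
    [TopologicalSpace X] [CompactSpace X] [TopologicalSpace.MetrizableSpace X]
    [MeasurableSpace X] [BorelSpace X] [SMul G X] [ContinuousSMul G X] : MeasurableSMul₂ G X := by
  let := TopologicalSpace.metrizableSpaceMetric X
  exact ⟨(continuous_smul (M := G) (X := X)).measurable⟩

end RelStationary

/-! ### The relative structure theorem -/

open RelStationary in
theorem theorem1p2 {G X Y : Type*}
    [Group G] [TopologicalSpace G] [IsTopologicalGroup G] [LocallyCompactSpace G]
    [SecondCountableTopology G] [T2Space G] [MeasurableSpace G] [BorelSpace G]
    [TopologicalSpace X] [CompactSpace X] [TopologicalSpace.MetrizableSpace X]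
    [MeasurableSpace X] [BorelSpace X] [MulAction G X] [ContinuousSMul G X]
    [MeasurableSpace Y] [StandardBorelSpace Y] [MulAction G Y] [MeasurableSMul₂ G Y]
    (μ : Measure G) [IsProbabilityMeasure μ] (hμ : IsAdmissible μ)
    (ν : Measure X) [IsProbabilityMeasure ν] (η : Measure Y) [IsProbabilityMeasure η]
    (π : X → Y) (hπ : IsRelStationary μ π ν η) :
    ∃ (ξ : Measure (ProbabilityMeasure X)) (φ : ProbabilityMeasure X → Y)
      (ρ : Measure (X × ProbabilityMeasure X)),
      IsProbabilityMeasure ξ ∧ IsProbabilityMeasure ρ ∧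
      IsRelBoundary μ φ ξ η ∧
      IsJoin μ π ν φ ξ η ρ ∧
      IsRelJoining μ π ν φ ξ η ρ ∧
      IsRelInjectiveInLimit μ Prod.fst (fun p : X × ProbabilityMeasure X => π p.1) ρ π ν η ∧
      IsRelMeasurePreserving G Prod.snd ρ ξ := by
  have : MeasurableSMul₂ G X := measurableSMul₂_of_continuousSMul
  have : MeasurableSMul₂ G (ProbabilityMeasure X) := measurableSMul₂_probabilityMeasure
  have : MeasurableSMul₂ G (X × ProbabilityMeasure X) := measurableSMul₂_prod
  have : BorelSpace (ProbabilityMeasure X) := borelSpace_probabilityMeasure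
  obtain ⟨D, hD, hst⟩ := hπ.stationary
  have hfac := hπ.factor
  have hη := hfac.nonsingular_target
  have hDm := hD.measurable_family
  have hst' : IsStationaryFamily μ η D := hst
  -- The default value where the limit fails to exist; any measure would do, as this happens only on
  -- a null set.
  let m₀ : ProbabilityMeasure X := ⟨ν, inferInstance⟩
  have : Nonempty X := m₀.nonempty
  have : Nonempty (ProbabilityMeasure X) := ⟨m₀⟩
  have : Nonempty Y := ‹Nonempty X›.map π
  let P := seqMeasure μ
  let L : Y → (ℕ → G) → ProbabilityMeasure X := limitMeasure D m₀
  have hL : Measurable (Function.uncurry L) := measurable_limitMeasure hDm m₀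
  have hLE : IsEquivariantFamily μ η L := isEquivariantFamily_limitMeasure hη hDm hst' m₀
  have hLlim : ∀ᵐ y ∂η, ∀ᵐ ω ∂P, IsLimitMeasure D y ω (L y ω) := by
    filter_upwards [ae_ae_exists_isLimitMeasure hη hDm hst'] with y hy
    filter_upwards [hy] with ω hω
    exact isLimitMeasure_limitMeasure m₀ hω
  have hLavg : ∀ᵐ y ∂η, average P L hL y = D y := average_limitMeasure hη hDm hst' m₀
  -- Since `D y` is the average of the `L y ω`, its null sets are null for almost every `L y ω`;
  -- this carries fibre concentration over to the limits.
  have hnull : ∀ y, average P L hL y = D y → ∀ A, MeasurableSet A → (D y : Measure X) A = 0 →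
      ∀ᵐ ω ∂P, (L y ω : Measure X) A = 0 := by
    intro y hy A hA h0
    rw [← hy, average_apply _ _ _ hA] at h0
    exact (lintegral_eq_zero_iff ((measurable_probabilityMeasure_iff.1 hL A hA).comp
      measurable_prodMk_left)).1 h0
  have hLfib : ∀ᵐ y ∂η, ∀ᵐ ω ∂P, (L y ω : Measure X) (π ⁻¹' {y})ᶜ = 0 := by
    filter_upwards [hLavg, hD.fibre] with y h1 h2
    exact hnull y h1 _ (hfac.measurable (measurableSet_singleton y)).compl h2
  obtain ⟨φ, hφm, hφ⟩ := exists_measurable_fibreMap hfac.measurable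
  let K₁ : Y → (ℕ → G) → ProbabilityMeasure (ProbabilityMeasure X) := fun y ω => diracProba (L y ω)
  let K₂ : Y → (ℕ → G) → ProbabilityMeasure (X × ProbabilityMeasure X) :=
    fun y ω => (L y ω).prod (diracProba (L y ω))
  have hK₁ : Measurable (Function.uncurry K₁) := measurable_diracProba.comp hL
  have hK₂ : Measurable (Function.uncurry K₂) := measurable_probabilityMeasure_prod hL hK₁
  have hE₁ : IsEquivariantFamily μ η K₁ := by
    filter_upwards [hLE] with y hy n
    filter_upwards [hy n] with p hp
    simp only [K₁]
    rw [hp, smul_diracProba]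
  have hE₂ : IsEquivariantFamily μ η K₂ := by
    filter_upwards [hLE] with y hy n
    filter_upwards [hy n] with p hp
    simp only [K₂]
    rw [hp, smul_prod, smul_diracProba]
  let R₁ := average P K₁ hK₁
  let R₂ := average P K₂ hK₂
  have hR₁ : IsStationaryFamily μ η R₁ := hE₁.isStationaryFamily hK₁
  have hR₂ : IsStationaryFamily μ η R₂ := hE₂.isStationaryFamily hK₂
  let ξ : Measure (ProbabilityMeasure X) := η.bind fun y => (R₁ y : Measure (ProbabilityMeasure X))
  let ρ : Measure (X × ProbabilityMeasure X) :=
    η.bind fun y => (R₂ y : Measure (X × ProbabilityMeasure X))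
  have hξ : IsProbabilityMeasure ξ := isProbabilityMeasure_bind_average hK₁
  have hρ : IsProbabilityMeasure ρ := isProbabilityMeasure_bind_average hK₂
  have hdirac : ∀ (y : Y) (ω : ℕ → G) (A : Set (ProbabilityMeasure X)), MeasurableSet A →
      L y ω ∉ A → (K₁ y ω : Measure (ProbabilityMeasure X)) A = 0 := by
    intro y ω A hA h
    change Measure.dirac (L y ω) A = 0
    rw [Measure.dirac_apply' _ hA, Set.indicator_of_notMem h]
  have hdis₁ : IsDisintegration φ ξ η R₁ := by
    refine isDisintegration_bind_average hK₁ hφm ?_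
    filter_upwards [hLfib] with y hy
    filter_upwards [hy] with ω hω
    exact hdirac _ _ _ (hφm (measurableSet_singleton y)).compl fun h => h (hφ _ _ hω)
  have hdis₂ : IsDisintegration (fun p : X × ProbabilityMeasure X => π p.1) ρ η R₂ := by
    refine isDisintegration_bind_average hK₂ (hfac.measurable.comp measurable_fst) ?_
    filter_upwards [hLfib] with y hy
    filter_upwards [hy] with ω hω
    have h : ((fun p : X × ProbabilityMeasure X => π p.1) ⁻¹' {y})ᶜ
        = (π ⁻¹' {y})ᶜ ×ˢ Set.univ := by
      ext p
      simp
    change ((L y ω : Measure X).prod (Measure.dirac (L y ω))) _ = 0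
    rw [h, Measure.prod_prod, hω, zero_mul]
  have hlim₁ : ∀ᵐ y ∂η, ∀ᵐ ω ∂P, IsLimitMeasure R₁ y ω (K₁ y ω) := hE₁.isLimitMeasure hK₁
  have hlim₂ : ∀ᵐ y ∂η, ∀ᵐ ω ∂P, IsLimitMeasure R₂ y ω (K₂ y ω) := hE₂.isLimitMeasure hK₂
  have hξns : IsNonsingular G ξ :=
    hR₁.isNonsingular hμ hη hdis₁.measurable_family hdis₁.integral
  have hρns : IsNonsingular G ρ :=
    hR₂.isNonsingular hμ hη hdis₂.measurable_family hdis₂.integral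
  have hdis₃ : IsDisintegration Prod.snd ρ ξ fun m => m.prod (diracProba m) :=
    isDisintegration_snd_prod_diracProba hK₁ hK₂
  have hρapply : ∀ A : Set (X × ProbabilityMeasure X), MeasurableSet A →
      ρ A = ∫⁻ y, ∫⁻ ω, (K₂ y ω : Measure (X × ProbabilityMeasure X)) A ∂P ∂η :=
    fun A hA => bind_average_apply hK₂ hA
  have hfacφ : IsFactorMap G φ ξ η := by
    refine isFactorMap_fibreMap hfac hφm hφ hξns (hdis₁.map_eq hφm) ?_ fun A hA h0 => ?_
    · refine bind_average_eq_zero hK₁ (measurable_measure_fibre_compl hfac.measurable hφm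
        (measurableSet_singleton 0)).compl ?_
      filter_upwards [hLfib] with y hy
      filter_upwards [hy] with ω hω
      refine hdirac _ _ _ (measurable_measure_fibre_compl hfac.measurable hφm
        (measurableSet_singleton 0)).compl fun h => h ?_
      change (L y ω : Measure X) (π ⁻¹' {φ (L y ω)})ᶜ = 0
      rw [hφ _ _ hω, hω]
    · have hmA : MeasurableSet {m : ProbabilityMeasure X | (m : Measure X) A = 0} :=
        measurable_probabilityMeasure_iff.1 measurable_id A hA (measurableSet_singleton 0)
      refine bind_average_eq_zero hK₁ hmA.compl ?_
      filter_upwards [hLavg, hD.ae_null hA h0] with y h1 h2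
      filter_upwards [hnull y h1 A hA h2] with ω hω
      exact hdirac _ _ _ hmA.compl fun h => h hω
  have hfst : IsFactorMap G (Prod.fst : X × ProbabilityMeasure X → X) ρ ν := by
    refine ⟨hρns, hfac.nonsingular_source, measurable_fst, ?_, Set.univ, Set.univ,
      MeasurableSet.univ, MeasurableSet.univ, by simp, by simp, fun _ _ _ => trivial,
      fun _ _ _ => rfl, ?_⟩
    · ext A hA
      rw [Measure.map_apply measurable_fst hA, hρapply _ (measurable_fst hA), hD.integral A hA]
      refine lintegral_congr_ae ?_
      filter_upwards [hLavg] with y hy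
      rw [← hy, average_apply _ _ _ hA]
      refine lintegral_congr fun ω => ?_
      change ((L y ω : Measure X).prod (Measure.dirac (L y ω))) _ = _
      rw [← Set.prod_univ, Measure.prod_prod, measure_univ, mul_one]
    · rw [Set.image_univ, Set.range_eq_univ]
      exact Prod.fst_surjective
  have hsnd : IsFactorMap G (Prod.snd : X × ProbabilityMeasure X → ProbabilityMeasure X) ρ ξ := by
    refine ⟨hρns, hξns, measurable_snd, hdis₃.map_eq measurable_snd, Set.univ, Set.univ,
      MeasurableSet.univ, MeasurableSet.univ, by simp, by simp, fun _ _ _ => trivial,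
      fun _ _ _ => rfl, ?_⟩
    rw [Set.image_univ, Set.range_eq_univ]
    exact Prod.snd_surjective
  have hψ : IsFactorMap G (fun p : X × ProbabilityMeasure X => π p.1) ρ η := by
    obtain ⟨X₀, Y₀, hX₀, hY₀, hνX₀, hηY₀, hinv, heq, himg⟩ := hfac.exists_conull
    refine ⟨hρns, hη, hfac.measurable.comp measurable_fst,
      hdis₂.map_eq (hfac.measurable.comp measurable_fst), Prod.fst ⁻¹' X₀, Y₀,
      measurable_fst hX₀, hY₀, ?_, hηY₀, fun g p hp => hinv g p.1 hp,
      fun g p hp => heq g p.1 hp, ?_⟩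
    · rw [← Set.preimage_compl, ← Measure.map_apply measurable_fst hX₀.compl, hfst.map_eq, hνX₀]
    · rw [← himg, ← Set.image_image π Prod.fst,
        Set.image_preimage_eq X₀ Prod.fst_surjective]
  have hcomm : ∀ᵐ p ∂ρ, π p.1 = φ p.2 := by
    have hs : MeasurableSet {p : X × ProbabilityMeasure X | π p.1 = φ p.2} :=
      measurableSet_eq_fun (hfac.measurable.comp measurable_fst) (hφm.comp measurable_snd)
    refine bind_average_eq_zero hK₂ hs.compl ?_
    filter_upwards [hLfib] with y hy
    filter_upwards [hy] with ω hω
    refine measure_mono_null (t := (π ⁻¹' {y})ᶜ ×ˢ Set.univ ∪ Set.univ ×ˢ {L y ω}ᶜ) ?_ ?_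
    · rintro ⟨x, m⟩ hp
      by_contra hn
      simp only [Set.mem_union, Set.mem_prod, Set.mem_compl_iff, Set.mem_preimage,
        Set.mem_singleton_iff, Set.mem_univ, and_true, true_and, not_or, not_not] at hn
      refine hp ?_
      change π x = φ m
      rw [hn.1, hn.2, hφ _ _ hω]
    · change ((L y ω : Measure X).prod (Measure.dirac (L y ω))) _ = 0
      refine measure_union_null ?_ ?_
      · rw [Measure.prod_prod, hω, zero_mul]
      · rw [Measure.prod_prod, Measure.dirac_apply' _ (measurableSet_singleton _).compl]
        simp
  have hφst : IsRelStationary μ φ ξ η := ⟨hfacφ, R₁, hdis₁, hR₁⟩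
  have hψst : IsRelStationary μ (fun p : X × ProbabilityMeasure X => π p.1) ρ η :=
    ⟨hψ, R₂, hdis₂, hR₂⟩
  refine ⟨ξ, φ, ρ, hξ, hρ, ⟨hφst, hfacφ, R₁, hdis₁, ?_⟩,
    ⟨D, R₁, L, K₁, hD, hdis₁, hL, hK₁, hLlim, hlim₁, hρapply⟩,
    ⟨hπ, hφst, hfst, hsnd, hcomm, hψst⟩,
    ⟨hψst, hπ, hfst, ae_of_all _ fun _ => rfl, R₂, D, hdis₂, hD, ?_⟩,
    ⟨hsnd, _, hdis₃, ae_of_all _ fun m g => ?_⟩⟩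
  · filter_upwards [hlim₁] with y hy
    filter_upwards [hy] with ω hω
    exact ⟨L y ω, hω⟩
  · filter_upwards [hLlim, hlim₂, hLfib] with y h1 h2 h3
    filter_upwards [h1, h2, h3] with ω h1 h2 h3
    -- The limit `L ⊗ δ_L` is carried by this slice, on which the second coordinate is constant, so
    -- the first one determines the point.
    refine ⟨K₂ y ω, L y ω, h2, h1, ?_, (π ⁻¹' {y}) ×ˢ {L y ω}, fun p hp => hp.1,
      (hfac.measurable (measurableSet_singleton y)).prod (measurableSet_singleton _), ?_, ?_⟩
    · change _ = Measure.map Prod.fst ((L y ω : Measure X).prod (Measure.dirac (L y ω)))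
      rw [Measure.map_fst_prod, measure_univ, one_smul]
    · change ((L y ω : Measure X).prod (Measure.dirac (L y ω))) _ = 0
      rw [Set.compl_prod_eq_union]
      refine measure_union_null ?_ ?_
      · rw [Measure.prod_prod, h3, zero_mul]
      · rw [Measure.prod_prod, Measure.dirac_apply' _ (measurableSet_singleton _).compl]
        simp
    · rintro ⟨x, m⟩ hp ⟨x', m'⟩ hp' hxx
      exact Prod.ext hxx ((Set.mem_singleton_iff.1 hp.2).trans (Set.mem_singleton_iff.1 hp'.2).symm)
  -- The version `m ↦ m ⊗ δ_m` is equivariant at every `m` and for every `g` at once, with no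
  -- exceptional set.
  · change g • (g⁻¹ • m).prod (diracProba (g⁻¹ • m)) = m.prod (diracProba m)
    rw [smul_prod, smul_diracProba, smul_inv_smul]
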